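/- Let $F\le \mathrm{Homeo}([0,1])$ be the R. Thompson group, i.e. the group of all increasing piecewise linear homeomorphisms of $[0,1]$ whose slopes are integer powers of $2$ and whose break points lie in $\mathbb{Z}[\frac12]$. For a finite set $U\subset(0,1)$ let $H_U$ be the subgroup of all elements of $F$ which fix every number in $U$, and let the type $\tau(U)$ be the word in the alphabet $\{1,2,3\}$, of length $|U|$, whose $i$-th letter is $1$, $2$ or $3$ according to whether the $i$-th smallest number in $U$ belongs to $\mathbb{Z}[\frac12]$, is rational but not in $\mathbb{Z}[\frac12]$, or is irrational. Consider triples $(T_+,T_-,\phi)$, where $T_+$ and $T_-$ are finite or infinite rooted planar binary trees (every vertex has either no child or a left and a right child) with the same finite number of infinite branches (a branch being a maximal simple path starting at the root), and $\phi$ is a bijection from the branches of $T_+$ to the branches of $T_-$ which preserves the left-to-right order and takes infinite branches to infinite branches. Label left edges by $0$ and right edges by $1$, so that each branch $p$ is a finite or infinite binary word; let $[p]=[.p,\,.p111\ldots]$ if $p$ is finite and $[p]=\{.p\}$ if $p$ is infinite. The triple defines the homeomorphism of $[0,1]$ which maps $[p]$ linearly and increasingly onto $[\phi(p)]$ for every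 branch $p$ of $T_+$. Let $\mathcal{F}\subset\mathrm{Homeo}([0,1])$ be the group of all homeomorphisms obtained in this way. Theorem. If $U$ and $V$ are finite subsets of $(0,1)$ with $\tau(U)=\tau(V)$, then $H_U$ and $H_V$ are conjugate by an element of $\mathcal{F}$: there is $f\in\mathcal{F}$ with $fH_Uf^{-1}=H_V$. -/

import Mathlib

namespace Thompson

/-- `x` is a finite binary fraction, i.e. an element of `ℤ[1/2]`. -/
def IsDyadic (x : ℝ) : Prop :=
  ∃ (a : ℤ) (n : ℕ), x = (a : ℝ) / 2 ^ n

/-- The group `Homeo([0,1])`.  In Mathlib's convention `(f * g) x = f (g x)`. -/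
abbrev HomeoI : Type := unitInterval ≃ₜ unitInterval

/-- `g` is an increasing piecewise linear homeomorphism of `[0,1]` whose break points all lie in a
finite set of elements of `ℤ[1/2]`, all slopes being integer powers of `2`: on every interval
`[a,b]` without a break point in its interior, `g` is affine with slope `2 ^ k`. -/
def IsThompson (g : HomeoI) : Prop :=
  StrictMono g ∧ ∃ S : Finset ℝ, (∀ s ∈ S, IsDyadic s) ∧
    ∀ a b : unitInterval, a ≤ b → (∀ s ∈ S, s ∉ Set.Ioo (a : ℝ) (b : ℝ)) →
      ∃ k : ℤ, ∀ x ∈ Set.Icc a b, ((g x : ℝ) - g a) = (2 : ℝ) ^ k * ((x : ℝ) - a)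

theorem IsDyadic.add {x y : ℝ} (hx : IsDyadic x) (hy : IsDyadic y) : IsDyadic (x + y) := by
  obtain ⟨a, n, rfl⟩ := hx
  obtain ⟨b, m, rfl⟩ := hy
  refine ⟨a * 2 ^ m + b * 2 ^ n, n + m, ?_⟩
  push_cast
  rw [pow_add]
  field_simp

theorem IsDyadic.neg {x : ℝ} (hx : IsDyadic x) : IsDyadic (-x) := by
  obtain ⟨a, n, rfl⟩ := hx
  exact ⟨-a, n, by push_cast; ring⟩

theorem IsDyadic.zpow_mul {x : ℝ} (hx : IsDyadic x) (k : ℤ) : IsDyadic ((2 : ℝ) ^ k * x) := by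
  obtain ⟨a, n, rfl⟩ := hx
  obtain ⟨m, rfl | rfl⟩ := k.eq_nat_or_neg
  · exact ⟨2 ^ m * a, n, by push_cast; rw [zpow_natCast]; ring⟩
  · refine ⟨a, n + m, ?_⟩
    rw [zpow_neg, zpow_natCast, pow_add]
    field_simp

theorem strictMono_zero {g : HomeoI} (hg : StrictMono g) : g 0 = 0 := by
  obtain ⟨x, hx⟩ := g.surjective 0
  have h : g 0 ≤ g x := hg.monotone unitInterval.nonneg'
  rw [hx] at h
  exact le_antisymm h unitInterval.nonneg'

/-- Elements of the Thompson group map `ℤ[1/2] ∩ [0,1]` into itself. -/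
theorem IsThompson.isDyadic {g : HomeoI} (hg : IsThompson g) (x : unitInterval)
    (hx : IsDyadic x) : IsDyadic (g x) := by
  classical
  obtain ⟨hmono, S, hS, hlin⟩ := hg
  generalize hn : (S.filter (fun s => s ∈ Set.Ioo (0 : ℝ) x)).card = n
  induction n using Nat.strong_induction_on generalizing x with
  | _ n ih =>
    rcases Finset.eq_empty_or_nonempty (S.filter (fun s => s ∈ Set.Ioo (0 : ℝ) x)) with he | hne
    · obtain ⟨k, hk⟩ := hlin 0 x unitInterval.nonneg' (by
        intro s hs hs'
        have : s ∈ S.filter (fun s => s ∈ Set.Ioo (0 : ℝ) x) :=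
          Finset.mem_filter.2 ⟨hs, by simpa using hs'⟩
        rw [he] at this
        exact absurd this (Finset.notMem_empty s))
      have h := hk x ⟨unitInterval.nonneg', le_rfl⟩
      rw [strictMono_zero hmono] at h
      have h' : (g x : ℝ) = 2 ^ k * (x : ℝ) := by simpa using h
      rw [h']
      exact hx.zpow_mul k
    · obtain ⟨m, hm, hmax⟩ := Finset.exists_max_image _ id hne
      have hm' := Finset.mem_filter.1 hm
      let y : unitInterval := ⟨m, hm'.2.1.le, hm'.2.2.le.trans x.2.2⟩
      have hyx : y ≤ x := hm'.2.2.le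
      have hdy : IsDyadic (g y) := by
        refine ih _ ?_ y (hS m hm'.1) rfl
        rw [← hn]
        refine Finset.card_lt_card (Finset.ssubset_iff_subset_ne.2 ⟨?_, ?_⟩)
        · intro s hs
          have hs' := Finset.mem_filter.1 hs
          exact Finset.mem_filter.2 ⟨hs'.1, hs'.2.1, hs'.2.2.trans hm'.2.2⟩
        · intro he
          rw [← he] at hm
          exact absurd (Finset.mem_filter.1 hm).2.2 (lt_irrefl _)
      obtain ⟨k, hk⟩ := hlin y x hyx (by
        intro s hs hs'
        have h1 : s ≤ m := hmax s (Finset.mem_filter.2 ⟨hs, hm'.2.1.trans hs'.1, hs'.2⟩)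
        exact absurd hs'.1 (not_lt.2 h1))
      have h := hk x ⟨hyx, le_rfl⟩
      have h' : (g x : ℝ) = 2 ^ k * ((x : ℝ) + -m) + g y := by
        have h2 : ((y : unitInterval) : ℝ) = m := rfl
        rw [h2] at h
        linarith
      rw [h']
      exact ((hx.add (hS m hm'.1).neg).zpow_mul k).add hdy

theorem IsThompson.one : IsThompson 1 :=
  ⟨fun _ _ h => h, ∅, by simp, fun a b _ _ => ⟨0, fun x _ => by simp⟩⟩

theorem IsThompson.inv {g : HomeoI} (hg : IsThompson g) : IsThompson g⁻¹ := by
  classical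
  have hd := hg.isDyadic
  obtain ⟨hmono, S, hS, hlin⟩ := hg
  have hinv : ∀ x, g (g⁻¹ x) = x := fun x => g.apply_symm_apply x
  have hmono' : StrictMono (g⁻¹ : HomeoI) := by
    intro a b hab
    rw [← hmono.lt_iff_lt, hinv, hinv]
    exact hab
  let E : ℝ → ℝ := fun s => if h : s ∈ Set.Icc (0 : ℝ) 1 then (g ⟨s, h⟩ : ℝ) else 0
  refine ⟨hmono', S.image E, ?_, ?_⟩
  · intro s hs
    obtain ⟨t, ht, rfl⟩ := Finset.mem_image.1 hs
    by_cases h : t ∈ Set.Icc (0 : ℝ) 1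
    · simp only [E, dif_pos h]
      exact hd ⟨t, h⟩ (hS t ht)
    · simp only [E, dif_neg h]
      exact ⟨0, 0, by simp⟩
  · intro a b hab hab'
    obtain ⟨k, hk⟩ := hlin (g⁻¹ a) (g⁻¹ b) (hmono'.monotone hab) (by
      intro s hs hs'
      have hI : s ∈ Set.Icc (0 : ℝ) 1 :=
        ⟨(g⁻¹ a).2.1.trans hs'.1.le, hs'.2.le.trans (g⁻¹ b).2.2⟩
      refine hab' (E s) (Finset.mem_image_of_mem _ hs) ?_
      simp only [E, dif_pos hI]
      have h1 : g (g⁻¹ a) < g ⟨s, hI⟩ := hmono hs'.1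
      have h2 : g ⟨s, hI⟩ < g (g⁻¹ b) := hmono hs'.2
      rw [hinv] at h1 h2
      exact ⟨h1, h2⟩)
    refine ⟨-k, fun x hx => ?_⟩
    have h := hk (g⁻¹ x) ⟨hmono'.monotone hx.1, hmono'.monotone hx.2⟩
    rw [hinv, hinv] at h
    rw [h, ← mul_assoc, ← zpow_add₀ (two_ne_zero)]
    simp

theorem IsThompson.mul {f g : HomeoI} (hf : IsThompson f) (hg : IsThompson g) :
    IsThompson (f * g) := by
  classical
  have hd := hg.inv.isDyadic
  obtain ⟨hgm, S, hS, hgl⟩ := hg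
  obtain ⟨hfm, R, hR, hfl⟩ := hf
  have hinv : ∀ x, g⁻¹ (g x) = x := fun x => g.symm_apply_apply x
  have hinv' : ∀ x, g (g⁻¹ x) = x := fun x => g.apply_symm_apply x
  let E : ℝ → ℝ := fun s => if h : s ∈ Set.Icc (0 : ℝ) 1 then ((g⁻¹ : HomeoI) ⟨s, h⟩ : ℝ) else 0
  refine ⟨hfm.comp hgm, S ∪ R.image E, ?_, ?_⟩
  · intro s hs
    rcases Finset.mem_union.1 hs with hs | hs
    · exact hS s hs
    obtain ⟨t, ht, rfl⟩ := Finset.mem_image.1 hs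
    by_cases h : t ∈ Set.Icc (0 : ℝ) 1
    · simp only [E, dif_pos h]
      exact hd ⟨t, h⟩ (hR t ht)
    · simp only [E, dif_neg h]
      exact ⟨0, 0, by simp⟩
  · intro a b hab hab'
    obtain ⟨k, hk⟩ := hgl a b hab (fun s hs => hab' s (Finset.mem_union_left _ hs))
    obtain ⟨l, hl⟩ := hfl (g a) (g b) (hgm.monotone hab) (by
      intro s hs hs'
      have hI : s ∈ Set.Icc (0 : ℝ) 1 := ⟨(g a).2.1.trans hs'.1.le, hs'.2.le.trans (g b).2.2⟩
      refine hab' (E s) (Finset.mem_union_right _ (Finset.mem_image_of_mem _ hs)) ?_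
      simp only [E, dif_pos hI]
      have h1 : a < g⁻¹ ⟨s, hI⟩ := by
        rw [← hgm.lt_iff_lt, hinv']
        exact hs'.1
      have h2 : g⁻¹ ⟨s, hI⟩ < b := by
        rw [← hgm.lt_iff_lt, hinv']
        exact hs'.2
      exact ⟨h1, h2⟩)
    refine ⟨l + k, fun x hx => ?_⟩
    have h1 := hk x hx
    have h2 := hl (g x) ⟨hgm.monotone hx.1, hgm.monotone hx.2⟩
    change ((f (g x) : ℝ) - f (g a)) = _
    rw [h2, h1, zpow_add₀ two_ne_zero, mul_assoc]

/-- The R. Thompson group `F`, as a subgroup of `Homeo([0,1])`. -/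
def F : Subgroup HomeoI where
  carrier := {g | IsThompson g}
  mul_mem' := fun hf hg => hf.mul hg
  one_mem' := IsThompson.one
  inv_mem' := fun hg => hg.inv

/-- `H_U`: the subgroup of all elements of `F` which fix every number in `U`. -/
def H (U : Finset ℝ) : Subgroup HomeoI where
  carrier := {h | h ∈ F ∧ ∀ x : unitInterval, (x : ℝ) ∈ U → h x = x}
  mul_mem' := fun {f g} hf hg => ⟨F.mul_mem hf.1 hg.1, fun x hx => by
    change f (g x) = x
    rw [hg.2 x hx, hf.2 x hx]⟩
  one_mem' := ⟨F.one_mem, fun _ _ => rfl⟩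
  inv_mem' := fun {f} hf => ⟨F.inv_mem hf.1, fun x hx => by
    change f.symm x = x
    rw [Homeomorph.symm_apply_eq, hf.2 x hx]⟩

open Classical in
/-- The letter of a number: `1` for elements of `ℤ[1/2]`, `2` for the other rational numbers, `3`
for irrational numbers. -/
noncomputable def letter (x : ℝ) : ℕ :=
  if IsDyadic x then 1 else if Irrational x then 3 else 2

/-- The type `τ(U)`: the word of the letters of the elements of `U`, in increasing order. -/
noncomputable def typeWord (U : Finset ℝ) : List ℕ :=
  (U.sort (· ≤ ·)).map letter

/-- A (finite or infinite) binary tree, given by the set of its vertices.  A vertex is given by the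
word read on the path from the root to it (`false` is `0` = left, `true` is `1` = right); every
vertex has either no child or both children. -/
structure BinTree where
  verts : Set (List Bool)
  root_mem : [] ∈ verts
  parent_mem : ∀ w b, w ++ [b] ∈ verts → w ∈ verts
  sibling_mem : ∀ w b, w ++ [b] ∈ verts → w ++ [!b] ∈ verts

/-- Finite or infinite binary words. -/
abbrev Word : Type := List Bool ⊕ (ℕ → Bool)

/-- The prefix of length `n` of an infinite binary word. -/
def initWord (ω : ℕ → Bool) (n : ℕ) : List Bool := (List.range n).map ω

/-- The (labels of) branches of a tree, i.e. of maximal simple paths starting at the root: finite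
branches end in a leaf, and an infinite branch has all its finite prefixes in the tree. -/
def BinTree.IsBranch (T : BinTree) : Word → Prop
  | Sum.inl w => w ∈ T.verts ∧ ∀ b, w ++ [b] ∉ T.verts
  | Sum.inr ω => ∀ n, initWord ω n ∈ T.verts

def BinTree.Branch (T : BinTree) : Type := {p : Word // T.IsBranch p}

/-- The set of infinite branches of a tree. -/
def BinTree.infBranches (T : BinTree) : Set (ℕ → Bool) := {ω | T.IsBranch (Sum.inr ω)}

/-- The finite word `u` is a prefix of `p`. -/
def HasPrefix (u : List Bool) : Word → Prop
  | Sum.inl w => u <+: w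
  | Sum.inr ω => u = initWord ω u.length

/-- `p` is to the left of `q`: after a common prefix, `p` turns left and `q` turns right. -/
def IsLeftOf (p q : Word) : Prop :=
  ∃ u : List Bool, HasPrefix (u ++ [false]) p ∧ HasPrefix (u ++ [true]) q

/-- A possibly infinite tree-diagram `(T₊, T₋, φ)` with finitely many infinite branches. -/
structure TreeDiagram where
  Tplus : BinTree
  Tminus : BinTree
  φ : Tplus.Branch ≃ Tminus.Branch
  finite_plus : Tplus.infBranches.Finite
  finite_minus : Tminus.infBranches.Finite
  card_eq : Tplus.infBranches.ncard = Tminus.infBranches.ncard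
  left_of : ∀ p q : Tplus.Branch, IsLeftOf p.1 q.1 → IsLeftOf (φ p).1 (φ q).1
  inf_to_inf : ∀ p : Tplus.Branch, p.1.isRight → (φ p).1.isRight

/-- The binary digit as a real number. -/
def digit (b : Bool) : ℝ := if b then 1 else 0

/-- The number `.w` for a finite binary word `w`. -/
noncomputable def finVal : List Bool → ℝ
  | [] => 0
  | b :: w => (digit b + finVal w) / 2

/-- The number `.ω` for an infinite binary word `ω`. -/
noncomputable def infVal (ω : ℕ → Bool) : ℝ := ∑' i, digit (ω i) / 2 ^ (i + 1)

/-- `g` maps the interval `[p]` linearly onto the interval `[q]`.  For a finite word `w` the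
interval is `[w] = [.w, .w + 2 ^ (-|w|)]`; for an infinite word it is the single point `.w`. -/
def MapsLinearly (g : HomeoI) : Word → Word → Prop
  | Sum.inl u, Sum.inl v => ∀ x : unitInterval,
      (x : ℝ) ∈ Set.Icc (finVal u) (finVal u + 1 / 2 ^ u.length) →
        (g x : ℝ) = finVal v + ((x : ℝ) - finVal u) * 2 ^ u.length / 2 ^ v.length
  | Sum.inr ω, Sum.inr ω' => ∀ x : unitInterval, (x : ℝ) = infVal ω → (g x : ℝ) = infVal ω'
  | _, _ => False

/-- The homeomorphism `g` is the one which corresponds to the tree-diagram `D`. -/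
def TreeDiagram.Represents (D : TreeDiagram) (g : HomeoI) : Prop :=
  ∀ p : D.Tplus.Branch, MapsLinearly g p.1 (D.φ p).1

/-- The underlying set of `𝓕`, viewed inside `Homeo([0,1])`: all homeomorphisms which correspond
to possibly infinite tree-diagrams with finitely many infinite branches. -/
def calF : Set HomeoI := {g | ∃ D : TreeDiagram, D.Represents g}

end Thompson

namespace Thompson

open Filter Topology Set

/-! The conjugator is built as an increasing bijection `f` of the line that carries `U` onto `V`,
fixes `0` and `1`, and looks like an element of `F` near every point outside `U`. Conjugation by
such an `f` can spoil membership in `F` only at points of `U`, and those are fixed by `H_U`, so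
everything depends on germs there.

At a dyadic point of `U`, `f` can itself be locally dyadic. At a non-dyadic `u`, an element of `F`
fixing `u` is a homothety `x ↦ 2 ^ k * (x - u) + u` near `u`, and the possible `k` form the subgroup
`periods u` of `ℤ`. It is trivial when `u` is irrational, so any `f` will do there. It is infinite
cyclic when `u` is rational, with generator `p`, say. Then `f` is defined freely on a fundamental
domain of the homothety of ratio `2 ^ (-p)`, on each side of `u`, and extended equivariantly, so
that generators of the two germ groups correspond. This is why the three letters are the only
invariant (`exists_left_map`, `exists_left_equivariant_map`, `exists_admissible_map`). A compactness
argument (`isThompson_restrict`) turns the local statement back into membership in `F`, whence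
`conj_mem_H`.

For `f ∈ 𝓕`, take the tree of dyadic intervals, subdivided until `f` maps them linearly onto dyadic
intervals. Near a point where `f` is locally dyadic the subdivision stops
(`LocallyDyadicAt.exists_isGood`), so infinite branches end at exceptional points, which are
finitely many. The same tree for the inverse map is the range tree (`Admissible.exists_mapsWord`).
-/

/-! ### Dyadic numbers -/

theorem IsDyadic.zero : IsDyadic 0 := ⟨0, 0, by simp⟩

theorem IsDyadic.one : IsDyadic 1 := ⟨1, 0, by simp⟩

theorem IsDyadic.sub {x y : ℝ} (hx : IsDyadic x) (hy : IsDyadic y) : IsDyadic (x - y) := by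
  rw [sub_eq_add_neg]
  exact hx.add hy.neg

theorem IsDyadic.of_zpow_mul {x : ℝ} {k : ℤ} (h : IsDyadic ((2 : ℝ) ^ k * x)) : IsDyadic x := by
  have := h.zpow_mul (-k)
  rwa [← mul_assoc, ← zpow_add₀ two_ne_zero, neg_add_cancel, zpow_zero, one_mul] at this

theorem isDyadic_affine_iff {k : ℤ} {d x : ℝ} (hd : IsDyadic d) :
    IsDyadic ((2 : ℝ) ^ k * x + d) ↔ IsDyadic x := by
  refine ⟨fun h => ?_, fun h => (h.zpow_mul k).add hd⟩
  have := h.sub hd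
  rw [add_sub_cancel_right] at this
  exact this.of_zpow_mul

theorem exists_isDyadic_between {a b : ℝ} (h : a < b) : ∃ c, IsDyadic c ∧ a < c ∧ c < b := by
  obtain ⟨n, hn⟩ := exists_pow_lt_of_lt_one (sub_pos.2 h) (by norm_num : (1 / 2 : ℝ) < 1)
  have hp : (0 : ℝ) < 2 ^ n := by positivity
  rw [one_div, inv_pow, inv_lt_iff_one_lt_mul₀ hp] at hn
  refine ⟨(⌊a * 2 ^ n⌋ + 1 : ℤ) / 2 ^ n, ⟨_, n, rfl⟩, ?_, ?_⟩
  · rw [lt_div_iff₀ hp]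
    push_cast
    exact Int.lt_floor_add_one _
  · rw [div_lt_iff₀ hp]
    push_cast
    have := Int.floor_le (a * 2 ^ n)
    nlinarith

/-! ### Germs of dyadic affine maps -/

/-- Along the filter `l`, the map `f` is affine with slope a power of `2` and constant term in
`ℤ[1/2]`. -/
def AffineAlong (l : Filter ℝ) (f : ℝ → ℝ) : Prop :=
  ∃ (k : ℤ) (d : ℝ), IsDyadic d ∧ ∀ᶠ y in l, f y = (2 : ℝ) ^ k * y + d

theorem AffineAlong.mono {l l' : Filter ℝ} {f : ℝ → ℝ} (h : AffineAlong l f) (hl : l' ≤ l) :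
    AffineAlong l' f := by
  obtain ⟨k, d, hd, h⟩ := h
  exact ⟨k, d, hd, hl h⟩

theorem AffineAlong.congr {l : Filter ℝ} {f g : ℝ → ℝ} (h : AffineAlong l f) (hg : g =ᶠ[l] f) :
    AffineAlong l g := by
  obtain ⟨k, d, hd, h⟩ := h
  refine ⟨k, d, hd, ?_⟩
  filter_upwards [h, hg] with y h1 h2
  rw [h2, h1]

theorem AffineAlong.comp {l l' : Filter ℝ} {f g : ℝ → ℝ} (hg : AffineAlong l' g)
    (hf : AffineAlong l f) (ht : Tendsto f l l') : AffineAlong l (fun x => g (f x)) := by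
  obtain ⟨k, d, hd, h⟩ := hf
  obtain ⟨k', d', hd', h'⟩ := hg
  refine ⟨k' + k, (2 : ℝ) ^ k' * d + d', (hd.zpow_mul k').add hd', ?_⟩
  filter_upwards [h, ht.eventually h'] with y h1 h2
  rw [h2, h1, zpow_add₀ two_ne_zero]
  ring

theorem AffineAlong.symm {l l' : Filter ℝ} {f : ℝ ≃o ℝ} (hf : AffineAlong l f)
    (ht : Tendsto f.symm l' l) : AffineAlong l' f.symm := by
  obtain ⟨k, d, hd, h⟩ := hf
  refine ⟨-k, -((2 : ℝ) ^ (-k) * d), (hd.zpow_mul _).neg, ?_⟩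
  filter_upwards [ht.eventually h] with y h1
  rw [OrderIso.apply_symm_apply] at h1
  have e : (2 : ℝ) ^ (-k) * 2 ^ k = 1 := by rw [← zpow_add₀ two_ne_zero]; simp
  linear_combination -(2 : ℝ) ^ (-k) * h1 - f.symm y * e

/-- Near `x`, the map `f` looks like an element of the group `F`. -/
def LocallyDyadicAt (f : ℝ → ℝ) (x : ℝ) : Prop :=
  AffineAlong (𝓝 x) f ∨ (IsDyadic x ∧ AffineAlong (𝓝[≤] x) f ∧ AffineAlong (𝓝[≥] x) f)

theorem LocallyDyadicAt.left {f : ℝ → ℝ} {x : ℝ} (h : LocallyDyadicAt f x) :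
    AffineAlong (𝓝[≤] x) f := by
  rcases h with h | h
  · exact h.mono nhdsWithin_le_nhds
  · exact h.2.1

theorem LocallyDyadicAt.right {f : ℝ → ℝ} {x : ℝ} (h : LocallyDyadicAt f x) :
    AffineAlong (𝓝[≥] x) f := by
  rcases h with h | h
  · exact h.mono nhdsWithin_le_nhds
  · exact h.2.2

theorem LocallyDyadicAt.congr {f g : ℝ → ℝ} {x : ℝ} (h : LocallyDyadicAt f x)
    (hg : g =ᶠ[𝓝 x] f) : LocallyDyadicAt g x := by
  rcases h with h | ⟨hx, h1, h2⟩
  · exact Or.inl (h.congr hg)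
  · exact Or.inr ⟨hx, h1.congr (hg.filter_mono nhdsWithin_le_nhds),
      h2.congr (hg.filter_mono nhdsWithin_le_nhds)⟩

theorem LocallyDyadicAt.isDyadic_iff {f : ℝ → ℝ} {x : ℝ} (h : LocallyDyadicAt f x) :
    IsDyadic (f x) ↔ IsDyadic x := by
  obtain ⟨k, d, hd, h⟩ := h.left
  -- The point `x` belongs to its closed half-neighbourhood, so the affine formula holds at `x`
  -- itself.
  rw [h.self_of_nhdsWithin self_mem_Iic]
  exact isDyadic_affine_iff hd

theorem tendsto_nhds (f : ℝ ≃o ℝ) (x : ℝ) : Tendsto f (𝓝 x) (𝓝 (f x)) := f.continuous.tendsto x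

theorem tendsto_nhdsLE (f : ℝ ≃o ℝ) (x : ℝ) : Tendsto f (𝓝[≤] x) (𝓝[≤] (f x)) :=
  f.continuous.continuousWithinAt.tendsto_nhdsWithin fun _ hy => f.monotone hy

theorem tendsto_nhdsGE (f : ℝ ≃o ℝ) (x : ℝ) : Tendsto f (𝓝[≥] x) (𝓝[≥] (f x)) :=
  f.continuous.continuousWithinAt.tendsto_nhdsWithin fun _ hy => f.monotone hy

/-- At a dyadic point one-sided formulas suffice. At a non-dyadic `x` the value `f x` is non-dyadic
too, which forces both germs to be two-sided. -/
theorem LocallyDyadicAt.trans {f g : ℝ ≃o ℝ} {x : ℝ} (hf : LocallyDyadicAt f x)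
    (hg : LocallyDyadicAt g (f x)) : LocallyDyadicAt (f.trans g) x := by
  have hl := hg.left.comp hf.left (tendsto_nhdsLE f x)
  have hr := hg.right.comp hf.right (tendsto_nhdsGE f x)
  have hd := hf.isDyadic_iff
  by_cases hx : IsDyadic x
  · exact Or.inr ⟨hx, hl, hr⟩
  · rcases hf with hf' | hf'
    · rcases hg with hg | hg
      · exact Or.inl (hg.comp hf' (tendsto_nhds f x))
      · exact absurd (hd.1 hg.1) hx
    · exact absurd hf'.1 hx

theorem LocallyDyadicAt.symm {f : ℝ ≃o ℝ} {x : ℝ} (hf : LocallyDyadicAt f x) :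
    LocallyDyadicAt f.symm (f x) := by
  have h1 := tendsto_nhds f.symm (f x)
  have h2 := tendsto_nhdsLE f.symm (f x)
  have h3 := tendsto_nhdsGE f.symm (f x)
  rw [f.symm_apply_apply] at h1 h2 h3
  have hd := hf.isDyadic_iff
  rcases hf with h | ⟨hx, hl, hr⟩
  · exact Or.inl (h.symm h1)
  · exact Or.inr ⟨hd.2 hx, hl.symm h2, hr.symm h3⟩

/-! ### Gluing, and maps between dyadic intervals -/

/-- The increasing bijection which agrees with `f` to the left of `b` and with `g` to the right. -/
noncomputable def glue (f g : ℝ ≃o ℝ) (b : ℝ) (h : f b = g b) : ℝ ≃o ℝ :=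
  StrictMono.orderIsoOfSurjective (fun x => if x ≤ b then f x else g x)
    (by
      intro x y hxy
      dsimp only
      split_ifs with h1 h2 h2
      · exact f.strictMono hxy
      · exact (f.monotone h1).trans_lt (h ▸ g.strictMono (not_le.1 h2))
      · exact absurd (hxy.le.trans h2) h1
      · exact g.strictMono hxy)
    (by
      intro y
      rcases le_or_gt y (f b) with hy | hy
      · exact ⟨f.symm y, by simp [f.symm_apply_le, hy]⟩
      · refine ⟨g.symm y, ?_⟩
        rw [h] at hy
        simp [g.symm_apply_le, hy])

theorem glue_of_le {f g : ℝ ≃o ℝ} {b : ℝ} (h : f b = g b) {x : ℝ} (hx : x ≤ b) :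
    glue f g b h x = f x := by
  change (if x ≤ b then f x else g x) = f x
  rw [if_pos hx]

theorem glue_of_ge {f g : ℝ ≃o ℝ} {b : ℝ} (h : f b = g b) {x : ℝ} (hx : b ≤ x) :
    glue f g b h x = g x := by
  change (if x ≤ b then f x else g x) = g x
  split_ifs with h1
  · rw [le_antisymm h1 hx, h]
  · rfl

theorem glue_eventuallyEq_left {f g : ℝ ≃o ℝ} {b : ℝ} (h : f b = g b) {x : ℝ} (hx : x < b) :
    glue f g b h =ᶠ[𝓝 x] f := by
  filter_upwards [Iio_mem_nhds hx] with y hy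
  exact glue_of_le h (le_of_lt hy)

theorem glue_eventuallyEq_right {f g : ℝ ≃o ℝ} {b : ℝ} (h : f b = g b) {x : ℝ} (hx : b < x) :
    glue f g b h =ᶠ[𝓝 x] g := by
  filter_upwards [Ioi_mem_nhds hx] with y hy
  exact glue_of_ge h (le_of_lt hy)

theorem LocallyDyadicAt.glue {f g : ℝ ≃o ℝ} {b : ℝ} (h : f b = g b) (hb : IsDyadic b) {x : ℝ}
    (hf : x ≤ b → LocallyDyadicAt f x) (hg : b ≤ x → LocallyDyadicAt g x) :
    LocallyDyadicAt (glue f g b h) x := by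
  rcases lt_trichotomy x b with hx | rfl | hx
  · exact (hf hx.le).congr (glue_eventuallyEq_left h hx)
  · refine Or.inr ⟨hb, (hf le_rfl).left.congr ?_, (hg le_rfl).right.congr ?_⟩
    · filter_upwards [self_mem_nhdsWithin] with y hy
      exact glue_of_le h hy
    · filter_upwards [self_mem_nhdsWithin] with y hy
      exact glue_of_ge h hy
  · exact (hg hx.le).congr (glue_eventuallyEq_right h hx)

/-- The affine map with slope `2 ^ k` and constant term `d`. -/
noncomputable def affineIso (k : ℤ) (d : ℝ) : ℝ ≃o ℝ :=
  StrictMono.orderIsoOfSurjective (fun x => (2 : ℝ) ^ k * x + d)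
    (by
      intro x y hxy
      have : (0 : ℝ) < 2 ^ k := by positivity
      dsimp only
      gcongr)
    (by
      intro y
      have : (2 : ℝ) ^ k ≠ 0 := by positivity
      refine ⟨(y - d) / 2 ^ k, ?_⟩
      field_simp
      ring)

@[simp] theorem affineIso_apply (k : ℤ) (d x : ℝ) : affineIso k d x = (2 : ℝ) ^ k * x + d := rfl

theorem locallyDyadicAt_affineIso (k : ℤ) {d : ℝ} (hd : IsDyadic d) (x : ℝ) :
    LocallyDyadicAt (affineIso k d) x :=
  Or.inl ⟨k, d, hd, Eventually.of_forall fun _ => rfl⟩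

/-- Each induction step doubles the last unit interval: the identity up to `n`, followed by slope
`2`, moves `n + 1` to `n + 2`. -/
theorem exists_iso_natCast (n : ℕ) : ∃ g : ℝ ≃o ℝ, (∀ x, LocallyDyadicAt g x) ∧
    g 0 = 0 ∧ g 1 = (n + 1 : ℕ) := by
  induction n with
  | zero => exact ⟨affineIso 0 0, locallyDyadicAt_affineIso 0 .zero, by simp, by simp⟩
  | succ n ih =>
    obtain ⟨g, hg, h0, h1⟩ := ih
    have hn : IsDyadic (n : ℝ) := ⟨n, 0, by simp⟩
    have hb : affineIso 0 0 (n : ℝ) = affineIso 1 (-n) (n : ℝ) := by simp; ring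
    refine ⟨g.trans (glue (affineIso 0 0) (affineIso 1 (-n)) n hb), fun x => (hg x).trans
      (.glue hb hn (fun _ => locallyDyadicAt_affineIso 0 .zero _)
        (fun _ => locallyDyadicAt_affineIso 1 hn.neg _)), ?_, ?_⟩
    · rw [OrderIso.trans_apply, h0, glue_of_le hb (by positivity)]
      simp
    · rw [OrderIso.trans_apply, h1, glue_of_ge hb (by push_cast; linarith)]
      push_cast
      simp
      ring

theorem exists_iso_of_pos {d : ℝ} (hd : IsDyadic d) (h : 0 < d) :
    ∃ g : ℝ ≃o ℝ, (∀ x, LocallyDyadicAt g x) ∧ g 0 = 0 ∧ g 1 = d := by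
  obtain ⟨a, n, rfl⟩ := hd
  have ha : 0 < a := by
    have : (0 : ℝ) < a := by
      by_contra hc
      exact absurd h (not_lt.2 (div_nonpos_of_nonpos_of_nonneg (not_lt.1 hc) (by positivity)))
    exact_mod_cast this
  obtain ⟨m, rfl⟩ : ∃ m : ℕ, a = (m + 1 : ℕ) := ⟨(a - 1).toNat, by omega⟩
  obtain ⟨g, hg, h0, h1⟩ := exists_iso_natCast m
  refine ⟨g.trans (affineIso (-n) 0), fun x => (hg x).trans
    (locallyDyadicAt_affineIso _ .zero _), ?_, ?_⟩
  · simp [h0]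
  · simp only [OrderIso.trans_apply, h1, affineIso_apply, zpow_neg, zpow_natCast]
    push_cast
    ring

/-- Any two intervals with dyadic end points are related by a dyadic map. -/
theorem exists_iso_map_interval {a b c d : ℝ} (ha : IsDyadic a) (hb : IsDyadic b)
    (hc : IsDyadic c) (hd : IsDyadic d) (hab : a < b) (hcd : c < d) :
    ∃ g : ℝ ≃o ℝ, (∀ x, LocallyDyadicAt g x) ∧ g a = c ∧ g b = d := by
  obtain ⟨g, hg, hg0, hg1⟩ := exists_iso_of_pos (hb.sub ha) (sub_pos.2 hab)
  obtain ⟨h, hh, hh0, hh1⟩ := exists_iso_of_pos (hd.sub hc) (sub_pos.2 hcd)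
  have hs : ∀ x, LocallyDyadicAt g.symm x := fun x => by
    have := (hg (g.symm x)).symm
    rwa [g.apply_symm_apply] at this
  refine ⟨(affineIso 0 (-a)).trans (g.symm.trans (h.trans (affineIso 0 c))), fun x =>
    (locallyDyadicAt_affineIso 0 ha.neg x).trans ((hs _).trans ((hh _).trans
      (locallyDyadicAt_affineIso 0 hc _))), ?_, ?_⟩
  · have : g.symm 0 = 0 := by rw [OrderIso.symm_apply_eq, hg0]
    simp [this, hh0]
  · have : g.symm (b - a) = 1 := by rw [OrderIso.symm_apply_eq, hg1]
    simp [← sub_eq_add_neg, this, hh1]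

/-! ### Gluing infinitely many maps -/

section Chain

variable {a c : ℕ → ℝ} {h : ℕ → ℝ ≃o ℝ}

/-- The map which agrees with `h i` on `[a i, a (i + 1)]` for `i ≤ n`. -/
noncomputable def chain (h₁ : ∀ n, h n (a n) = c n) (h₂ : ∀ n, h n (a (n + 1)) = c (n + 1))
    (ha : Monotone a) : (n : ℕ) → {g : ℝ ≃o ℝ // g (a (n + 1)) = c (n + 1)}
  | 0 => ⟨h 0, h₂ 0⟩
  | n + 1 => ⟨glue (chain h₁ h₂ ha n).1 (h (n + 1)) (a (n + 1))
      ((chain h₁ h₂ ha n).2.trans (h₁ _).symm), by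
        rw [glue_of_ge _ (ha (Nat.le_succ _)), h₂]⟩

variable (h₁ : ∀ n, h n (a n) = c n) (h₂ : ∀ n, h n (a (n + 1)) = c (n + 1)) (ha : Monotone a)

theorem chain_apply_eq (n : ℕ) :
    (chain h₁ h₂ ha n).1 (a (n + 1)) = h (n + 1) (a (n + 1)) :=
  (chain h₁ h₂ ha n).2.trans (h₁ _).symm

theorem chain_of_le {n m : ℕ} (hnm : n ≤ m) {x : ℝ} (hx : x ≤ a (n + 1)) :
    (chain h₁ h₂ ha m).1 x = (chain h₁ h₂ ha n).1 x := by
  induction m, hnm using Nat.le_induction with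
  | base => rfl
  | succ m hm ih =>
    rw [← ih]
    exact glue_of_le (chain_apply_eq h₁ h₂ ha m) (hx.trans (ha (by omega)))

theorem chain_of_ge (n : ℕ) {x : ℝ} (hx : a n ≤ x) : (chain h₁ h₂ ha n).1 x = h n x := by
  cases n with
  | zero => rfl
  | succ n => exact glue_of_ge (chain_apply_eq h₁ h₂ ha n) hx

theorem locallyDyadicAt_chain (hd : ∀ n, IsDyadic (a n)) (hh : ∀ n x, LocallyDyadicAt (h n) x)
    (n : ℕ) (x : ℝ) : LocallyDyadicAt (chain h₁ h₂ ha n).1 x := by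
  induction n with
  | zero => exact hh 0 x
  | succ n ih => exact .glue (chain_apply_eq h₁ h₂ ha n) (hd _) (fun _ => ih) (fun _ => hh _ _)

end Chain

/-- Infinitely many dyadic maps, given on consecutive intervals which accumulate at `u`, can be
glued. -/
theorem exists_infinite_glue {a c : ℕ → ℝ} {h : ℕ → ℝ ≃o ℝ} {u v : ℝ}
    (h₁ : ∀ n, h n (a n) = c n) (h₂ : ∀ n, h n (a (n + 1)) = c (n + 1))
    (ha : StrictMono a) (hc : StrictMono c) (hau : Tendsto a atTop (𝓝 u))
    (hcv : Tendsto c atTop (𝓝 v)) (hd : ∀ n, IsDyadic (a n))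
    (hh : ∀ n x, LocallyDyadicAt (h n) x) :
    ∃ G : ℝ ≃o ℝ, G u = v ∧ (∀ x < u, LocallyDyadicAt G x) ∧
      ∀ n, ∀ x ∈ Icc (a n) (a (n + 1)), G x = h n x := by
  classical
  have hlt : ∀ n, a n < u := fun n =>
    (ha (Nat.lt_succ_self n)).trans_le (ha.monotone.ge_of_tendsto hau _)
  have hlt' : ∀ n, c n < v := fun n =>
    (hc (Nat.lt_succ_self n)).trans_le (hc.monotone.ge_of_tendsto hcv _)
  have hex : ∀ x < u, ∃ n, x < a (n + 1) := fun x hx =>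
    ((hau.comp (tendsto_add_atTop_nat 1)).eventually (lt_mem_nhds hx)).exists
  have hex' : ∀ x < v, ∃ n, x < c (n + 1) := fun x hx =>
    ((hcv.comp (tendsto_add_atTop_nat 1)).eventually (lt_mem_nhds hx)).exists
  let C := chain h₁ h₂ ha.monotone
  -- The translation beyond `u` only serves to make `G` a bijection of the line; `hG` shows that the
  -- chosen index is immaterial.
  let G : ℝ → ℝ := fun x => if hx : x < u then (C (hex x hx).choose).1 x else x - u + v
  have hG : ∀ n x, x ≤ a (n + 1) → G x = (C n).1 x := by
    intro n x hx
    have hxu : x < u := hx.trans_lt (hlt _)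
    simp only [G, dif_pos hxu]
    have hs := (hex x hxu).choose_spec
    rcases le_total n (hex x hxu).choose with hle | hle
    · exact chain_of_le h₁ h₂ ha.monotone hle hx
    · exact (chain_of_le h₁ h₂ ha.monotone hle hs.le).symm
  have hG' : ∀ x, u ≤ x → G x = x - u + v := fun x hx => dif_neg (not_lt.2 hx)
  have hmono : StrictMono G := by
    intro x y hxy
    rcases lt_or_ge y u with hy | hy
    · obtain ⟨n, hn⟩ := hex y hy
      rw [hG n y hn.le, hG n x (hxy.trans hn).le]
      exact (C n).1.strictMono hxy
    · rcases lt_or_ge x u with hx | hx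
      · obtain ⟨n, hn⟩ := hex x hx
        rw [hG n x hn.le, hG' y hy]
        have := (C n).1.strictMono hn
        rw [(C n).2] at this
        linarith [hlt' (n + 1)]
      · rw [hG' x hx, hG' y hy]
        linarith
  have hsurj : Function.Surjective G := by
    intro y
    rcases lt_or_ge y v with hy | hy
    · obtain ⟨n, hn⟩ := hex' y hy
      refine ⟨(C n).1.symm y, ?_⟩
      rw [hG n, OrderIso.apply_symm_apply]
      rw [OrderIso.symm_apply_le, (C n).2]
      exact hn.le
    · exact ⟨y - v + u, by rw [hG' _ (by linarith)]; ring⟩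
  refine ⟨hmono.orderIsoOfSurjective G hsurj, ?_, ?_, ?_⟩
  · change G u = v
    rw [hG' u le_rfl]
    ring
  · intro x hx
    obtain ⟨n, hn⟩ := hex x hx
    refine (locallyDyadicAt_chain h₁ h₂ ha.monotone hd hh n x).congr ?_
    filter_upwards [Iio_mem_nhds hn] with y hy
    exact hG n y (le_of_lt hy)
  · intro n x hx
    exact (hG n x hx.2).trans (chain_of_ge h₁ h₂ ha.monotone n hx.1)

/-! ### Reflection, homotheties and the periods of a point -/

/-- Conjugation of a map by `x ↦ -x`. -/
def reflect (g : ℝ ≃o ℝ) : ℝ ≃o ℝ where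
  toFun x := -g (-x)
  invFun x := -g.symm (-x)
  left_inv x := by simp
  right_inv x := by simp
  map_rel_iff' := by simp

@[simp] theorem reflect_apply (g : ℝ ≃o ℝ) (x : ℝ) : reflect g x = -g (-x) := rfl

theorem AffineAlong.reflect {l l' : Filter ℝ} {g : ℝ ≃o ℝ} (h : AffineAlong l g)
    (ht : Tendsto (fun x : ℝ => -x) l' l) : AffineAlong l' (reflect g) := by
  obtain ⟨k, d, hd, h⟩ := h
  refine ⟨k, -d, hd.neg, ?_⟩
  filter_upwards [ht.eventually h] with y hy
  rw [reflect_apply, hy]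
  ring

theorem LocallyDyadicAt.reflect {g : ℝ ≃o ℝ} {x : ℝ} (h : LocallyDyadicAt g (-x)) :
    LocallyDyadicAt (reflect g) x := by
  rcases h with h | ⟨hx, hl, hr⟩
  · exact Or.inl (h.reflect (continuous_neg.tendsto x))
  · refine Or.inr ⟨?_, ?_, ?_⟩
    · simpa using hx.neg
    · exact hr.reflect (continuous_neg.continuousWithinAt.tendsto_nhdsWithin
        fun y hy => neg_le_neg (mem_Iic.1 hy))
    · exact hl.reflect (continuous_neg.continuousWithinAt.tendsto_nhdsWithin
        fun y hy => neg_le_neg (mem_Ici.1 hy))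

/-- The homothety with ratio `2 ^ k` and centre `u`. -/
noncomputable def homothety (k : ℤ) (u : ℝ) : ℝ ≃o ℝ := affineIso k ((1 - 2 ^ k) * u)

theorem homothety_apply (k : ℤ) (u x : ℝ) : homothety k u x = 2 ^ k * x + (1 - 2 ^ k) * u := rfl

theorem homothety_apply_sub (k : ℤ) (u x : ℝ) : homothety k u x - u = 2 ^ k * (x - u) := by
  rw [homothety_apply]
  ring

@[simp] theorem homothety_self (k : ℤ) (u : ℝ) : homothety k u u = u := by
  rw [homothety_apply]
  ring

@[simp] theorem homothety_zero (u x : ℝ) : homothety 0 u x = x := by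
  simp [homothety_apply]

theorem homothety_add (k l : ℤ) (u x : ℝ) :
    homothety (k + l) u x = homothety k u (homothety l u x) := by
  simp only [homothety_apply, zpow_add₀ (two_ne_zero : (2 : ℝ) ≠ 0)]
  ring

theorem homothety_neg_center (k : ℤ) (u x : ℝ) : homothety k (-u) x = -homothety k u (-x) := by
  simp only [homothety_apply]
  ring

theorem homothety_neg_pos_lt {p : ℕ} (hp : 0 < p) {u x : ℝ} (hx : x < u) :
    x < homothety (-p) u x := by
  have h1 : (2 : ℝ) ^ (-(p : ℤ)) < 1 := zpow_lt_one_of_neg₀ (by norm_num) (by omega)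
  have h2 := homothety_apply_sub (-p) u x
  nlinarith

/-- The exponents `k` for which the homothety with ratio `2 ^ k` and centre `u` is dyadic. -/
def periods (u : ℝ) : AddSubgroup ℤ where
  carrier := {k | IsDyadic ((1 - 2 ^ k) * u)}
  zero_mem' := by simpa using IsDyadic.zero
  add_mem' := by
    intro k l hk hl
    have := hk.add (hl.zpow_mul k)
    change IsDyadic _
    convert this using 1
    rw [zpow_add₀ two_ne_zero]
    ring
  neg_mem' := by
    intro k hk
    have := (hk.zpow_mul (-k)).neg
    change IsDyadic _
    convert this using 1
    have : (2 : ℝ) ^ (-k) * 2 ^ k = 1 := by rw [← zpow_add₀ two_ne_zero]; simp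
    linear_combination -u * this

theorem mem_periods {u : ℝ} {k : ℤ} : k ∈ periods u ↔ IsDyadic ((1 - 2 ^ k) * u) := Iff.rfl

theorem locallyDyadicAt_homothety {k : ℤ} {u : ℝ} (h : k ∈ periods u) (x : ℝ) :
    LocallyDyadicAt (homothety k u) x :=
  locallyDyadicAt_affineIso k h x

theorem IsDyadic.not_irrational {x : ℝ} (h : IsDyadic x) : ¬ Irrational x := by
  obtain ⟨a, n, rfl⟩ := h
  rw [Irrational, not_not]
  exact ⟨a / 2 ^ n, by push_cast; rfl⟩

/-- For `k ≠ 0` the factor `1 - 2 ^ k` is a nonzero rational, so its product with `u` stays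
irrational. -/
theorem eq_zero_of_mem_periods {u : ℝ} (hu : Irrational u) {k : ℤ} (hk : k ∈ periods u) :
    k = 0 := by
  by_contra h0
  have hne : ((1 - 2 ^ k : ℚ)) ≠ 0 := by
    intro h
    have : (2 : ℚ) ^ k = 1 := by linarith
    rw [zpow_eq_one_iff_right₀ (by norm_num) (by norm_num)] at this
    exact h0 this
  refine IsDyadic.not_irrational hk ?_
  have := hu.ratCast_mul hne
  push_cast at this
  exact this

/-- Euler's theorem: if the denominator of `u` is `2 ^ m * r` with `r` odd, then `r` divides `1 - 2
^ φ(r)`, which leaves a power of `2` as denominator. -/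
theorem exists_mem_periods {u : ℝ} (hu : ¬ Irrational u) : ∃ k ∈ periods u, 0 < k := by
  rw [Irrational, not_not] at hu
  obtain ⟨q, rfl⟩ := hu
  obtain ⟨m, r, hr, hq⟩ := Nat.exists_eq_two_pow_mul_odd q.den_ne_zero
  have hmod := Nat.ModEq.pow_totient (Nat.coprime_two_left.2 hr)
  obtain ⟨t, ht⟩ := (Nat.modEq_iff_dvd).1 hmod
  have hrpos : 0 < r := hr.pos
  refine ⟨(Nat.totient r : ℕ), ?_, by exact_mod_cast Nat.totient_pos.2 hrpos⟩
  refine ⟨t * q.num, m, ?_⟩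
  have ht' : (1 - 2 ^ Nat.totient r : ℝ) = r * t := by exact_mod_cast ht
  rw [zpow_natCast, ht', Rat.cast_def, hq]
  have : (r : ℝ) ≠ 0 := by positivity
  push_cast
  field_simp

theorem exists_generator_periods {u : ℝ} (hu : ¬ Irrational u) :
    ∃ p : ℕ, 0 < p ∧ ∀ k, k ∈ periods u ↔ (p : ℤ) ∣ k := by
  obtain ⟨a, ha⟩ := Int.subgroup_cyclic (periods u)
  have hmem : ∀ k, k ∈ periods u ↔ (a.natAbs : ℤ) ∣ k := by
    intro k
    rw [ha, AddSubgroup.mem_closure_singleton, Int.natAbs_dvd]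
    constructor
    · rintro ⟨n, rfl⟩
      exact ⟨n, by simp [mul_comm]⟩
    · rintro ⟨n, rfl⟩
      exact ⟨n, by simp [mul_comm]⟩
  refine ⟨a.natAbs, ?_, hmem⟩
  obtain ⟨k, hk, h0⟩ := exists_mem_periods hu
  rw [hmem] at hk
  rcases Nat.eq_zero_or_pos a.natAbs with h | h
  · rw [h] at hk
    simp at hk
    omega
  · exact h

/-! ### Maps on the left of a point -/

theorem exists_dyadic_seq {a u : ℝ} (ha : IsDyadic a) (hau : a < u) :
    ∃ s : ℕ → ℝ, s 0 = a ∧ StrictMono s ∧ Tendsto s atTop (𝓝 u) ∧ ∀ n, IsDyadic (s n) := by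
  have hdense : Dense {x : ℝ | IsDyadic x} := dense_of_exists_between fun x y hxy => by
    obtain ⟨c, hc, h1, h2⟩ := exists_isDyadic_between hxy
    exact ⟨c, hc, h1, h2⟩
  obtain ⟨s, hs, hmem, ht⟩ := hdense.exists_seq_strictMono_tendsto_of_lt hau
  refine ⟨fun n => n.casesOn a s, rfl, strictMono_nat_of_lt_succ ?_, ?_, ?_⟩
  · rintro (_ | n)
    · exact (hmem 0).1.1
    · exact hs (Nat.lt_succ_self n)
  · rw [← tendsto_add_atTop_iff_nat 1]
    exact ht
  · rintro (_ | n)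
    · exact ha
    · exact (hmem n).2

/-- Dyadic sequences increase from `a` to `u` and from `c` to `v`, and consecutive intervals are
matched. The germ at `u` is uncontrolled, which is harmless at irrational points. -/
theorem exists_left_map {a c u v : ℝ} (ha : IsDyadic a) (hc : IsDyadic c) (hau : a < u)
    (hcv : c < v) :
    ∃ G : ℝ ≃o ℝ, G u = v ∧ G a = c ∧ ∀ x < u, LocallyDyadicAt G x := by
  obtain ⟨s, hs0, hs, hst, hsd⟩ := exists_dyadic_seq ha hau
  obtain ⟨t, ht0, ht, htt, htd⟩ := exists_dyadic_seq hc hcv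
  choose h hh h₁ h₂ using fun n => exists_iso_map_interval (hsd n) (hsd (n + 1)) (htd n)
    (htd (n + 1)) (hs (Nat.lt_succ_self n)) (ht (Nat.lt_succ_self n))
  obtain ⟨G, hG, hG', hG''⟩ := exists_infinite_glue h₁ h₂ hs ht hst htt hsd hh
  refine ⟨G, hG, ?_, hG'⟩
  rw [← hs0, ← ht0, hG'' 0 _ ⟨le_rfl, hs.monotone (Nat.zero_le 1)⟩, h₁]

theorem strictMono_homothety {p : ℕ} (hp : 0 < p) {a u : ℝ} (hau : a < u) :
    StrictMono fun n : ℕ => homothety (-(p * n : ℕ)) u a := by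
  refine strictMono_nat_of_lt_succ fun n => ?_
  have : (-((p * (n + 1) : ℕ) : ℤ)) = -p + -(p * n : ℕ) := by push_cast; ring
  rw [this, homothety_add]
  refine homothety_neg_pos_lt hp ?_
  calc homothety (-(p * n : ℕ)) u a < homothety (-(p * n : ℕ)) u u :=
        (homothety _ u).strictMono hau
    _ = u := homothety_self _ _

theorem tendsto_homothety {p : ℕ} (hp : 0 < p) (a u : ℝ) :
    Tendsto (fun n : ℕ => homothety (-(p * n : ℕ)) u a) atTop (𝓝 u) := by
  have h1 : Tendsto (fun n : ℕ => ((1 / 2 : ℝ) ^ p) ^ n * (a - u) + u) atTop (𝓝 (0 * (a - u) + u)) :=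
    ((tendsto_pow_atTop_nhds_zero_of_lt_one (by positivity)
      (pow_lt_one₀ (by norm_num) (by norm_num) hp.ne')).mul_const _).add_const _
  rw [zero_mul, zero_add] at h1
  refine h1.congr fun n => ?_
  rw [homothety_apply, zpow_neg, zpow_natCast, ← pow_mul, one_div, inv_pow]
  ring

theorem isDyadic_homothety {k : ℤ} {u a : ℝ} (h : k ∈ periods u) (ha : IsDyadic a) :
    IsDyadic (homothety k u a) :=
  (ha.zpow_mul k).add h

theorem neg_mul_mem_periods {p : ℕ} {u : ℝ} (h : (p : ℤ) ∈ periods u) (n : ℕ) :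
    (-(p * n : ℕ) : ℤ) ∈ periods u := by
  have := (periods u).neg_mem ((periods u).nsmul_mem h n)
  convert this using 1
  simp [mul_comm]

/-- The interval from `a` to its image under the homothety of ratio `2 ^ (-p)` is a fundamental
domain on `[a, u)`. A dyadic map chosen on it is transported to all its images; since `p` and `q`
are periods, the transported pieces remain dyadic. -/
theorem exists_left_equivariant_map {a c u v : ℝ} {p q : ℕ} (hp : 0 < p) (hq : 0 < q)
    (hpu : (p : ℤ) ∈ periods u) (hqv : (q : ℤ) ∈ periods v) (ha : IsDyadic a) (hc : IsDyadic c)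
    (hau : a < u) (hcv : c < v) :
    ∃ G : ℝ ≃o ℝ, G u = v ∧ G a = c ∧ (∀ x < u, LocallyDyadicAt G x) ∧
      ∀ᶠ x in 𝓝[≤] u, G (homothety (-p) u x) = homothety (-q) v (G x) := by
  have hs := strictMono_homothety hp hau
  have ht := strictMono_homothety hq hcv
  set s : ℕ → ℝ := fun n : ℕ => homothety (-(p * n : ℕ)) u a with hsdef
  set t : ℕ → ℝ := fun n : ℕ => homothety (-(q * n : ℕ)) v c with htdef
  have hsd : ∀ n, IsDyadic (s n) := fun n => isDyadic_homothety (neg_mul_mem_periods hpu n) ha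
  have htd : ∀ n, IsDyadic (t n) := fun n => isDyadic_homothety (neg_mul_mem_periods hqv n) hc
  have hs0 : s 0 = a := by simp [hsdef]
  have ht0 : t 0 = c := by simp [htdef]
  have hs1 : ∀ n, s (n + 1) = homothety (-(p * n : ℕ)) u (s 1) := by
    intro n
    rw [hsdef]
    dsimp only
    rw [← homothety_add]
    congr 2
    push_cast
    ring
  have ht1 : ∀ n, t (n + 1) = homothety (-(q * n : ℕ)) v (t 1) := by
    intro n
    rw [htdef]
    dsimp only
    rw [← homothety_add]
    congr 2
    push_cast
    ring
  obtain ⟨g, hg, hg₁, hg₂⟩ := exists_iso_map_interval (hsd 0) (hsd 1) (htd 0) (htd 1)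
    (hs zero_lt_one) (ht zero_lt_one)
  rw [hs0, ht0] at hg₁
  -- Return to the fundamental domain, apply `g`, and move out again on the side of `v`.
  let h : ℕ → ℝ ≃o ℝ := fun n => (homothety (p * n : ℕ) u).trans
    (g.trans (homothety (-(q * n : ℕ)) v))
  have hinv : ∀ (n : ℕ) x, homothety (p * n : ℕ) u (homothety (-(p * n : ℕ)) u x) = x := by
    intro n x
    rw [← homothety_add, add_neg_cancel, homothety_zero]
  have h₁ : ∀ n, h n (s n) = t n := by
    intro n
    simp only [h, OrderIso.trans_apply, hsdef, hinv, hg₁, htdef]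
  have h₂ : ∀ n, h n (s (n + 1)) = t (n + 1) := by
    intro n
    rw [hs1, ht1]
    simp only [h, OrderIso.trans_apply, hinv, hg₂]
  have hh : ∀ n x, LocallyDyadicAt (h n) x := by
    intro n x
    refine (locallyDyadicAt_homothety ?_ x).trans ((hg _).trans
      (locallyDyadicAt_homothety (neg_mul_mem_periods hqv n) _))
    have := (periods u).neg_mem (neg_mul_mem_periods hpu n)
    rwa [neg_neg] at this
  obtain ⟨G, hG, hG', hG''⟩ := exists_infinite_glue h₁ h₂ hs ht (tendsto_homothety hp a u)
    (tendsto_homothety hq c v) hsd hh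
  refine ⟨G, hG, ?_, hG', ?_⟩
  · rw [← hs0, ← ht0, hG'' 0 _ ⟨le_rfl, hs.monotone (Nat.zero_le 1)⟩, h₁]
  · filter_upwards [self_mem_nhdsWithin, nhdsWithin_le_nhds (Ioi_mem_nhds hau)] with x hx hax
    rcases eq_or_lt_of_le (show x ≤ u from hx) with rfl | hxu
    · rw [homothety_self, hG, homothety_self]
    have hex : ∃ n, x ≤ s (n + 1) := (((tendsto_homothety hp a u).comp
      (tendsto_add_atTop_nat 1)).eventually (le_mem_nhds hxu)).exists
    classical
    obtain ⟨n, hn₁, hn₂⟩ : ∃ n, s n ≤ x ∧ x ≤ s (n + 1) := by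
      -- The least such `n` works: its predecessor fails the bound, and for `n = 0` the lower bound
      -- is `a < x`.
      refine ⟨Nat.find hex, ?_, Nat.find_spec hex⟩
      rcases hf : Nat.find hex with _ | m
      · rw [hs0]
        exact le_of_lt hax
      · exact (not_le.1 (Nat.find_min hex (by omega : m < Nat.find hex))).le
    have hshift : ∀ m, s (m + 1) = homothety (-p) u (s m) := by
      intro m
      rw [hsdef]
      dsimp only
      rw [← homothety_add]
      congr 2
      push_cast
      ring
    rw [hG'' n x ⟨hn₁, hn₂⟩, hG'' (n + 1) _ ⟨by
      rw [hshift]; exact (homothety _ _).monotone hn₁, by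
      rw [hshift]; exact (homothety _ _).monotone hn₂⟩]
    simp only [h, OrderIso.trans_apply]
    rw [← homothety_add, ← homothety_add]
    congr 2
    · push_cast
      ring
    · congr 2
      push_cast
      ring

/-! ### Conjugation of germs at non-dyadic points -/

/-- Conjugation by `f` relates the germs of dyadic affine maps which fix `x` with those which fix
`f x`, where `x` and `f x` are not dyadic. -/
structure ConjugatesAt (f : ℝ → ℝ) (x : ℝ) : Prop where
  not_isDyadic : ¬ IsDyadic x
  not_isDyadic_image : ¬ IsDyadic (f x)
  forth : ∀ k ∈ periods x, ∃ l ∈ periods (f x),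
    ∀ᶠ z in 𝓝 x, f (homothety k x z) = homothety l (f x) (f z)
  back : ∀ l ∈ periods (f x), ∃ k ∈ periods x,
    ∀ᶠ z in 𝓝 x, f (homothety k x z) = homothety l (f x) (f z)

theorem tendsto_homothety_nhds (k : ℤ) (u : ℝ) : Tendsto (homothety k u) (𝓝 u) (𝓝 u) := by
  simpa using tendsto_nhds (homothety k u) u

theorem ConjugatesAt.congr {f g : ℝ → ℝ} {x : ℝ} (h : ConjugatesAt f x) (hg : g =ᶠ[𝓝 x] f) :
    ConjugatesAt g x := by
  have hx : g x = f x := hg.self_of_nhds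
  have key : ∀ k l, (∀ᶠ z in 𝓝 x, f (homothety k x z) = homothety l (f x) (f z)) →
      ∀ᶠ z in 𝓝 x, g (homothety k x z) = homothety l (f x) (g z) := by
    intro k l hkl
    filter_upwards [hkl, hg, (tendsto_homothety_nhds k x).eventually hg] with z h1 h2 h3
    rw [h2, h3, h1]
  refine ⟨h.not_isDyadic, hx ▸ h.not_isDyadic_image, fun k hk => ?_, fun l hl => ?_⟩
  · obtain ⟨l, hl, he⟩ := h.forth k hk
    exact ⟨l, hx ▸ hl, hx ▸ key k l he⟩
  · obtain ⟨k, hk, he⟩ := h.back l (hx ▸ hl)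
    exact ⟨k, hk, hx ▸ key k l he⟩

theorem ConjugatesAt.symm {f : ℝ ≃o ℝ} {x : ℝ} (h : ConjugatesAt f x) :
    ConjugatesAt f.symm (f x) := by
  have hx : f.symm (f x) = x := f.symm_apply_apply x
  have ht := tendsto_nhds f.symm (f x)
  rw [hx] at ht
  have key : ∀ k l, (∀ᶠ z in 𝓝 x, f (homothety k x z) = homothety l (f x) (f z)) →
      ∀ᶠ z in 𝓝 (f x), f.symm (homothety l (f x) z) = homothety k x (f.symm z) := by
    intro k l hkl
    filter_upwards [ht.eventually hkl] with z h1
    rw [f.apply_symm_apply] at h1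
    rw [← h1, f.symm_apply_apply]
  refine ⟨h.not_isDyadic_image, by rw [hx]; exact h.not_isDyadic, fun l hl => ?_, fun k hk => ?_⟩
  · obtain ⟨k, hk, he⟩ := h.back l hl
    exact ⟨k, by rwa [hx], by rw [hx]; exact key k l he⟩
  · rw [hx] at hk
    obtain ⟨l, hl, he⟩ := h.forth k hk
    exact ⟨l, hl, by rw [hx]; exact key k l he⟩

/-- Both groups of periods are trivial, so there is only the identity germ to match. -/
theorem conjugatesAt_of_irrational {f : ℝ → ℝ} {u : ℝ} (hu : Irrational u)
    (hv : Irrational (f u)) : ConjugatesAt f u := by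
  refine ⟨fun h => h.not_irrational hu, fun h => h.not_irrational hv, fun k hk => ?_,
    fun l hl => ?_⟩
  · rw [eq_zero_of_mem_periods hu hk]
    exact ⟨0, (periods _).zero_mem, by simp⟩
  · rw [eq_zero_of_mem_periods hv hl]
    exact ⟨0, (periods _).zero_mem, by simp⟩

/-- Homotheties fix their centre, so a relation valid near `u` can be iterated near `u`. -/
theorem eventually_homothety_mul {f : ℝ ≃o ℝ} {u : ℝ} {p q : ℤ}
    (h : ∀ᶠ z in 𝓝 u, f (homothety p u z) = homothety q (f u) (f z)) (m : ℤ) :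
    ∀ᶠ z in 𝓝 u, f (homothety (p * m) u z) = homothety (q * m) (f u) (f z) := by
  have hnat : ∀ n : ℕ, ∀ᶠ z in 𝓝 u,
      f (homothety (p * n) u z) = homothety (q * n) (f u) (f z) := by
    intro n
    induction n with
    | zero => simp
    | succ n ih =>
      filter_upwards [ih, (tendsto_homothety_nhds (p * n) u).eventually h] with z h1 h2
      push_cast
      rw [mul_add, mul_add, mul_one, mul_one, add_comm, add_comm (q * _), homothety_add,
        homothety_add, h2, h1]
  obtain ⟨n, rfl | rfl⟩ := m.eq_nat_or_neg
  · exact hnat n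
  -- For a negative exponent, the relation for `n` is evaluated at the point already moved by the
  -- inverse homothety.
  · filter_upwards [(tendsto_homothety_nhds (p * -n) u).eventually (hnat n)] with z h1
    rw [← homothety_add] at h1
    rw [show p * (n : ℤ) + p * -n = 0 by ring, homothety_zero] at h1
    rw [h1, ← homothety_add, show q * -(n : ℤ) + q * n = 0 by ring, homothety_zero]

theorem conjugatesAt_of_generators {f : ℝ ≃o ℝ} {u : ℝ} {p q : ℕ} (hu : ¬ IsDyadic u)
    (hv : ¬ IsDyadic (f u)) (hp : ∀ k, k ∈ periods u ↔ (p : ℤ) ∣ k)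
    (hq : ∀ k, k ∈ periods (f u) ↔ (q : ℤ) ∣ k)
    (h : ∀ᶠ z in 𝓝 u, f (homothety (-p) u z) = homothety (-q) (f u) (f z)) :
    ConjugatesAt f u := by
  refine ⟨hu, hv, fun k hk => ?_, fun l hl => ?_⟩
  · obtain ⟨m, rfl⟩ := (hp k).1 hk
    refine ⟨q * m, (hq _).2 (dvd_mul_right _ _), ?_⟩
    -- The given relation is for the contracting generators `-p` and `-q`, hence the sign.
    simpa using eventually_homothety_mul h (-m)
  · obtain ⟨m, rfl⟩ := (hq l).1 hl
    refine ⟨p * m, (hp _).2 (dvd_mul_right _ _), ?_⟩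
    simpa using eventually_homothety_mul h (-m)

theorem periods_neg (u : ℝ) : periods (-u) = periods u := by
  ext k
  rw [mem_periods, mem_periods, mul_neg]
  exact ⟨fun h => by simpa using h.neg, fun h => h.neg⟩

/-- A map of a left neighbourhood and a map of a right neighbourhood, the latter given by its
reflection, are put together. -/
theorem exists_two_sided {L R : ℝ ≃o ℝ} {u v : ℝ} (hL : L u = v) (hR : R (-u) = -v)
    (hL' : ∀ x < u, LocallyDyadicAt L x) (hR' : ∀ x < -u, LocallyDyadicAt R x) :
    ∃ g : ℝ ≃o ℝ, (∀ x ≤ u, g x = L x) ∧ (∀ x, u ≤ x → g x = -R (-x)) ∧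
      ∀ x ≠ u, LocallyDyadicAt g x := by
  have h : L u = reflect R u := by rw [reflect_apply, hR, hL, neg_neg]
  refine ⟨glue L (reflect R) u h, fun x hx => glue_of_le h hx, fun x hx => glue_of_ge h hx,
    fun x hx => ?_⟩
  rcases lt_or_gt_of_ne hx with hx | hx
  · exact (hL' x hx).congr (glue_eventuallyEq_left h hx)
  · exact (hR' (-x) (neg_lt_neg hx)).reflect.congr (glue_eventuallyEq_right h hx)

theorem exists_map_of_irrational {u v c e : ℝ} (hu : Irrational u) (hv : Irrational v)
    (hc : IsDyadic c) (he : IsDyadic e) (huc : u < c) (hve : v < e) :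
    ∃ g : ℝ ≃o ℝ, g u = v ∧ g c = e ∧ (∀ x ≠ u, LocallyDyadicAt g x) ∧ ConjugatesAt g u := by
  obtain ⟨a, ha, -, hau⟩ := exists_isDyadic_between (sub_one_lt u)
  obtain ⟨b, hb, -, hbv⟩ := exists_isDyadic_between (sub_one_lt v)
  obtain ⟨L, hL, -, hL'⟩ := exists_left_map ha hb hau hbv
  obtain ⟨R, hR, hRc, hR'⟩ := exists_left_map hc.neg he.neg (neg_lt_neg huc) (neg_lt_neg hve)
  obtain ⟨g, h1, h2, h3⟩ := exists_two_sided hL hR hL' hR'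
  have hgu : g u = v := by rw [h1 u le_rfl, hL]
  exact ⟨g, hgu, by rw [h2 c huc.le, hRc, neg_neg], h3,
    conjugatesAt_of_irrational hu (by rwa [hgu])⟩

/-- The right half is the reflection of a left half at `-u`. As `-u` and `u` have the same periods,
both halves can be made equivariant for the same pair of generators, and the relation holds on a
full neighbourhood. -/
theorem exists_map_of_not_irrational {u v c e : ℝ} (hu : ¬ Irrational u) (hv : ¬ Irrational v)
    (hu' : ¬ IsDyadic u) (hv' : ¬ IsDyadic v)
    (hc : IsDyadic c) (he : IsDyadic e) (huc : u < c) (hve : v < e) :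
    ∃ g : ℝ ≃o ℝ, g u = v ∧ g c = e ∧ (∀ x ≠ u, LocallyDyadicAt g x) ∧ ConjugatesAt g u := by
  obtain ⟨a, ha, -, hau⟩ := exists_isDyadic_between (sub_one_lt u)
  obtain ⟨b, hb, -, hbv⟩ := exists_isDyadic_between (sub_one_lt v)
  obtain ⟨p, hp, hpu⟩ := exists_generator_periods hu
  obtain ⟨q, hq, hqv⟩ := exists_generator_periods hv
  have hpm := (hpu p).2 dvd_rfl
  have hqm := (hqv q).2 dvd_rfl
  obtain ⟨L, hL, -, hL', hLe⟩ := exists_left_equivariant_map hp hq hpm hqm ha hb hau hbv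
  obtain ⟨R, hR, hRc, hR', hRe⟩ := exists_left_equivariant_map hp hq
    (by rwa [periods_neg]) (by rwa [periods_neg]) hc.neg he.neg (neg_lt_neg huc)
    (neg_lt_neg hve)
  obtain ⟨g, h1, h2, h3⟩ := exists_two_sided hL hR hL' hR'
  have hgu : g u = v := by rw [h1 u le_rfl, hL]
  refine ⟨g, hgu, by rw [h2 c huc.le, hRc, neg_neg], h3,
    conjugatesAt_of_generators hu' (by rwa [hgu]) hpu (by rwa [hgu]) ?_⟩
  rw [hgu, ← nhdsLE_sup_nhdsGE, eventually_sup]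
  constructor
  · filter_upwards [hLe, self_mem_nhdsWithin] with x hx hxu
    have hle : homothety (-p) u x ≤ u := by
      simpa using (homothety (-p) u).monotone hxu
    rw [h1 _ hle, h1 _ hxu, hx]
  · have ht : Tendsto (fun x : ℝ => -x) (𝓝[≥] u) (𝓝[≤] (-u)) :=
      continuous_neg.continuousWithinAt.tendsto_nhdsWithin fun y hy => neg_le_neg (mem_Ici.1 hy)
    filter_upwards [ht.eventually hRe, self_mem_nhdsWithin] with x hx hxu
    have hle : u ≤ homothety (-p) u x := by
      simpa using (homothety (-p) u).monotone hxu
    rw [homothety_neg_center, homothety_neg_center, neg_neg] at hx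
    rw [h2 _ hle, h2 _ hxu, hx, neg_neg]

/-! ### Admissible maps between sequences of the same type -/

theorem letter_eq_one_iff {x : ℝ} : letter x = 1 ↔ IsDyadic x := by
  unfold letter
  split_ifs <;> simp_all

theorem letter_eq_three_iff {x : ℝ} : letter x = 3 ↔ Irrational x := by
  unfold letter
  split_ifs with h1 h2
  · simp [h1.not_irrational]
  · simp [h2]
  · simp [h2]

/-- The map `f` is admissible at `x`. -/
def AdmissibleAt (f : ℝ → ℝ) (x : ℝ) : Prop := LocallyDyadicAt f x ∨ ConjugatesAt f x

theorem AdmissibleAt.congr {f g : ℝ → ℝ} {x : ℝ} (h : AdmissibleAt f x) (hg : g =ᶠ[𝓝 x] f) :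
    AdmissibleAt g x :=
  h.imp (fun h => h.congr hg) (fun h => h.congr hg)

/-- The prescribed dyadic value at a dyadic `c` to the right of `u` is what allows gluing to a map
already built for the larger points. -/
theorem exists_map_of_letter_eq {u v c e : ℝ} (h : letter u = letter v)
    (hc : IsDyadic c) (he : IsDyadic e) (huc : u < c) (hve : v < e) :
    ∃ g : ℝ ≃o ℝ, g u = v ∧ g c = e ∧ (∀ x ≠ u, LocallyDyadicAt g x) ∧ AdmissibleAt g u := by
  have hd : IsDyadic u ↔ IsDyadic v := by rw [← letter_eq_one_iff, h, letter_eq_one_iff]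
  have hi : Irrational u ↔ Irrational v := by rw [← letter_eq_three_iff, h, letter_eq_three_iff]
  by_cases hu : IsDyadic u
  · obtain ⟨g, hg, hg1, hg2⟩ := exists_iso_map_interval hu hc (hd.1 hu) he huc hve
    exact ⟨g, hg1, hg2, fun x _ => hg x, Or.inl (hg u)⟩
  · by_cases hu' : Irrational u
    · obtain ⟨g, h1, h2, h3, h4⟩ := exists_map_of_irrational hu' (hi.1 hu') hc he huc hve
      exact ⟨g, h1, h2, h3, Or.inr h4⟩
    · obtain ⟨g, h1, h2, h3, h4⟩ := exists_map_of_not_irrational hu' (hu' ∘ hi.2) hu (hu ∘ hd.2)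
        hc he huc hve
      exact ⟨g, h1, h2, h3, Or.inr h4⟩

theorem exists_gt_forall_mem_le (l : List ℝ) (m : ℝ) (h : ∀ z ∈ l, m < z) :
    ∃ b, m < b ∧ ∀ z ∈ l, b ≤ z := by
  induction l with
  | nil => exact ⟨m + 1, by linarith, by simp⟩
  | cons x l ih =>
    obtain ⟨b, hb, hb'⟩ := ih fun z hz => h z (List.mem_cons_of_mem _ hz)
    refine ⟨min b x, lt_min hb (h x List.mem_cons_self), ?_⟩
    intro z hz
    rcases List.mem_cons.1 hz with rfl | hz
    · exact min_le_right _ _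
    · exact (min_le_left _ _).trans (hb' z hz)

/-- Increasing sequences of the same type are related by an admissible map. -/
theorem exists_admissible_map : ∀ us vs : List ℝ, us.Pairwise (· < ·) → vs.Pairwise (· < ·) →
    us.map letter = vs.map letter → ∃ f : ℝ ≃o ℝ, us.map f = vs ∧
      (∀ x ∉ us, LocallyDyadicAt f x) ∧ ∀ x ∈ us, AdmissibleAt f x
  | [], [], _, _, _ => ⟨affineIso 0 0, rfl, fun x _ => locallyDyadicAt_affineIso 0 .zero x, by simp⟩
  | [], _ :: _, _, _, h => by simp at h
  | _ :: _, [], _, _, h => by simp at h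
  | u :: us, v :: vs, hu, hv, h => by
    rw [List.pairwise_cons] at hu hv
    rw [List.map_cons, List.map_cons, List.cons.injEq] at h
    obtain ⟨f, hf, hf1, hf2⟩ := exists_admissible_map us vs hu.2 hv.2 h.2
    -- The gluing point `c` must exceed `u` and lie before all later points, and `f c` must exceed
    -- `v`.
    obtain ⟨b, hb, hb'⟩ := exists_gt_forall_mem_le us (max u (f.symm v)) (by
      intro z hz
      refine max_lt (hu.1 z hz) ?_
      rw [OrderIso.symm_apply_lt]
      exact hv.1 _ (hf ▸ List.mem_map_of_mem hz))
    obtain ⟨c, hc, hc1, hc2⟩ := exists_isDyadic_between hb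
    have hus : ∀ z ∈ us, c < z := fun z hz => hc2.trans_le (hb' z hz)
    have hcf : LocallyDyadicAt f c := hf1 c fun hm => lt_irrefl _ (hus c hm)
    have huc : u < c := (le_max_left _ _).trans_lt hc1
    obtain ⟨g, hg1, hg2, hg3, hg4⟩ := exists_map_of_letter_eq h.1 hc (hcf.isDyadic_iff.2 hc) huc
      (e := f c) (by rw [← OrderIso.symm_apply_lt]; exact (le_max_right _ _).trans_lt hc1)
    refine ⟨glue g f c hg2, ?_, ?_, ?_⟩
    · rw [List.map_cons, glue_of_le hg2 huc.le, hg1, ← hf]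
      congr 1
      exact List.map_congr_left fun z hz => glue_of_ge hg2 (hus z hz).le
    · intro x hx
      rw [List.mem_cons, not_or] at hx
      exact .glue hg2 hc (fun _ => hg3 x hx.1) (fun _ => hf1 x hx.2)
    · intro x hx
      rcases List.mem_cons.1 hx with rfl | hx
      · exact hg4.congr (glue_eventuallyEq_left hg2 huc)
      · exact (hf2 x hx).congr (glue_eventuallyEq_right hg2 (hus x hx))

/-! ### Between homeomorphisms of the unit interval and of the line -/

/-- The restriction to `[0,1]` of an increasing bijection which fixes `0` and `1`. -/
noncomputable def restrict (f : ℝ ≃o ℝ) (h0 : f 0 = 0) (h1 : f 1 = 1) : HomeoI :=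
  OrderIso.toHomeomorph
    { toFun := fun x => ⟨f x, h0 ▸ f.monotone x.2.1, h1 ▸ f.monotone x.2.2⟩
      invFun := fun x => ⟨f.symm x, by rw [f.le_symm_apply, h0]; exact x.2.1,
        by rw [f.symm_apply_le, h1]; exact x.2.2⟩
      left_inv := fun x => by simp
      right_inv := fun x => by simp
      map_rel_iff' := fun {x y} => f.le_iff_le (x := (x : ℝ)) (y := (y : ℝ)) }

@[simp] theorem restrict_apply (f : ℝ ≃o ℝ) (h0 : f 0 = 0) (h1 : f 1 = 1) (x : unitInterval) :
    (restrict f h0 h1 x : ℝ) = f x := rfl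

theorem restrict_inv_apply (f : ℝ ≃o ℝ) (h0 : f 0 = 0) (h1 : f 1 = 1) (x : unitInterval) :
    (((restrict f h0 h1)⁻¹ : HomeoI) x : ℝ) = f.symm x := rfl

theorem strictMono_one {g : HomeoI} (hg : StrictMono g) : g 1 = 1 := by
  obtain ⟨x, hx⟩ := g.surjective 1
  have h : g x ≤ g 1 := hg.monotone unitInterval.le_one'
  rw [hx] at h
  exact le_antisymm unitInterval.le_one' h

open Classical in
/-- The extension by the identity of an increasing homeomorphism of `[0,1]`. -/
noncomputable def extend (g : HomeoI) (hg : StrictMono g) : ℝ ≃o ℝ :=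
  StrictMono.orderIsoOfSurjective
    (fun x => if hx : x ∈ Icc (0 : ℝ) 1 then (g ⟨x, hx⟩ : ℝ) else x)
    (by
      intro x y hxy
      dsimp only
      split_ifs with hx hy hy
      · exact hg hxy
      · have : 1 < y := by
          by_contra hc
          exact hy ⟨hx.1.trans hxy.le, not_lt.1 hc⟩
        exact (g ⟨x, hx⟩).2.2.trans_lt this
      · have : x < 0 := by
          by_contra hc
          exact hx ⟨not_lt.1 hc, hxy.le.trans hy.2⟩
        exact this.trans_le (g ⟨y, hy⟩).2.1
      · exact hxy)
    (by
      intro y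
      by_cases hy : y ∈ Icc (0 : ℝ) 1
      · refine ⟨g.symm ⟨y, hy⟩, ?_⟩
        dsimp only
        rw [dif_pos (g.symm ⟨y, hy⟩).2]
        simp
      · exact ⟨y, dif_neg hy⟩)

theorem extend_of_mem {g : HomeoI} (hg : StrictMono g) (x : unitInterval) :
    extend g hg x = g x := dif_pos x.2

theorem extend_of_notMem {g : HomeoI} (hg : StrictMono g) {x : ℝ} (hx : x ∉ Icc (0 : ℝ) 1) :
    extend g hg x = x := dif_neg hx

theorem affineAlong_id (l : Filter ℝ) : AffineAlong l fun x => x :=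
  ⟨0, 0, .zero, by simp⟩

theorem extend_of_le_zero {g : HomeoI} (hg : StrictMono g) {x : ℝ} (hx : x ≤ 0) :
    extend g hg x = x := by
  rcases hx.eq_or_lt with rfl | hx
  · have := extend_of_mem hg 0
    rw [strictMono_zero hg] at this
    simpa using this
  · exact extend_of_notMem hg fun h => not_lt.2 h.1 hx

theorem extend_of_one_le {g : HomeoI} (hg : StrictMono g) {x : ℝ} (hx : 1 ≤ x) :
    extend g hg x = x := by
  rcases hx.eq_or_lt with rfl | hx
  · have := extend_of_mem hg 1
    rw [strictMono_one hg] at this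
    simpa using this
  · exact extend_of_notMem hg fun h => not_lt.2 h.2 hx

theorem exists_last_le (S : Finset ℝ) {x z : ℝ} (hz : z ∈ S) (hzx : z ≤ x) :
    ∃ a ∈ S, a ≤ x ∧ ∀ s ∈ S, s ≤ x → s ≤ a := by
  classical
  obtain ⟨a, ha, hmax⟩ := (S.filter (· ≤ x)).exists_max_image id ⟨z, by simp [hz, hzx]⟩
  rw [Finset.mem_filter] at ha
  exact ⟨a, ha.1, ha.2, fun s hs hsx => hmax s (by simp [hs, hsx])⟩

theorem exists_last_lt (S : Finset ℝ) {x z : ℝ} (hz : z ∈ S) (hzx : z < x) :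
    ∃ a ∈ S, a < x ∧ ∀ s ∈ S, s < x → s ≤ a := by
  classical
  obtain ⟨a, ha, hmax⟩ := (S.filter (· < x)).exists_max_image id ⟨z, by simp [hz, hzx]⟩
  rw [Finset.mem_filter] at ha
  exact ⟨a, ha.1, ha.2, fun s hs hsx => hmax s (by simp [hs, hsx])⟩

theorem exists_first_ge (S : Finset ℝ) {x z : ℝ} (hz : z ∈ S) (hzx : x ≤ z) :
    ∃ a ∈ S, x ≤ a ∧ ∀ s ∈ S, x ≤ s → a ≤ s := by
  classical
  obtain ⟨a, ha, hmax⟩ := (S.filter (x ≤ ·)).exists_min_image id ⟨z, by simp [hz, hzx]⟩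
  rw [Finset.mem_filter] at ha
  exact ⟨a, ha.1, ha.2, fun s hs hsx => hmax s (by simp [hs, hsx])⟩

theorem exists_first_gt (S : Finset ℝ) {x z : ℝ} (hz : z ∈ S) (hzx : x < z) :
    ∃ a ∈ S, x < a ∧ ∀ s ∈ S, x < s → a ≤ s := by
  classical
  obtain ⟨a, ha, hmax⟩ := (S.filter (x < ·)).exists_min_image id ⟨z, by simp [hz, hzx]⟩
  rw [Finset.mem_filter] at ha
  exact ⟨a, ha.1, ha.2, fun s hs hsx => hmax s (by simp [hs, hsx])⟩

/-- Between consecutive break points the constant term is dyadic because a break point and its image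
are; outside `[0,1]` the extension is the identity. The points `0` and `1` are added because the
extension may break there. -/
theorem IsThompson.locallyDyadicAt {g : HomeoI} (hg : IsThompson g) (x : ℝ) :
    LocallyDyadicAt (extend g hg.1) x := by
  classical
  have hdy := hg.isDyadic
  obtain ⟨S, hS, hlin⟩ := hg.2
  have hmono := hg.1
  set S' : Finset ℝ := insert 0 (insert 1 S) with hS'
  have h0 : (0 : ℝ) ∈ S' := by simp [hS']
  have h1 : (1 : ℝ) ∈ S' := by simp [hS']
  have hS'd : ∀ s ∈ S', IsDyadic s := by
    intro s hs
    rw [hS', Finset.mem_insert, Finset.mem_insert] at hs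
    rcases hs with rfl | rfl | hs
    · exact .zero
    · exact .one
    · exact hS s hs
  have key : ∀ a ∈ S', ∀ b : ℝ, 0 ≤ a → a ≤ b → b ≤ 1 → (∀ s ∈ S', ¬ (a < s ∧ s < b)) →
      ∃ (k : ℤ) (d : ℝ), IsDyadic d ∧ ∀ y ∈ Icc a b, extend g hmono y = 2 ^ k * y + d := by
    intro a ha b h0a hab hb1 hnone
    let A : unitInterval := ⟨a, h0a, hab.trans hb1⟩
    let B : unitInterval := ⟨b, h0a.trans hab, hb1⟩
    obtain ⟨k, hk⟩ := hlin A B hab fun s hs => hnone s (by simp [hS', hs])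
    refine ⟨k, g A - 2 ^ k * a, (hdy A (hS'd a ha)).sub ((hS'd a ha).zpow_mul k), ?_⟩
    intro y hy
    let Y : unitInterval := ⟨y, h0a.trans hy.1, hy.2.trans hb1⟩
    have h2 := hk Y ⟨hy.1, hy.2⟩
    have h3 : extend g hmono y = g Y := extend_of_mem hmono Y
    rw [h3]
    change (g Y : ℝ) - g A = 2 ^ k * (y - a) at h2
    linarith
  by_cases hx : x ∈ S'
  · refine Or.inr ⟨hS'd x hx, ?_, ?_⟩
    · by_cases hin : 0 < x ∧ x ≤ 1
      · obtain ⟨a, ha, hax, hmax⟩ := exists_last_lt S' h0 hin.1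
        obtain ⟨k, d, hd, h⟩ := key a ha x (hmax 0 h0 hin.1) hax.le hin.2
          fun s hs h => absurd (hmax s hs h.2) (not_le.2 h.1)
        refine ⟨k, d, hd, ?_⟩
        filter_upwards [self_mem_nhdsWithin, nhdsWithin_le_nhds (Ioi_mem_nhds hax)] with y h2 h3
        exact h y ⟨le_of_lt h3, h2⟩
      · refine (affineAlong_id _).congr ?_
        rcases le_or_gt x 0 with h | h
        · filter_upwards [self_mem_nhdsWithin] with y hy
          exact extend_of_le_zero hmono (le_trans hy h)
        · have hx1 : 1 < x := by
            by_contra hc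
            exact hin ⟨h, not_lt.1 hc⟩
          filter_upwards [nhdsWithin_le_nhds (Ioi_mem_nhds hx1)] with y hy
          exact extend_of_one_le hmono (le_of_lt hy)
    · by_cases hin : 0 ≤ x ∧ x < 1
      · obtain ⟨b, hb, hxb, hmin⟩ := exists_first_gt S' h1 hin.2
        obtain ⟨k, d, hd, h⟩ := key x hx b hin.1 hxb.le (hmin 1 h1 hin.2)
          fun s hs h => absurd (hmin s hs h.1) (not_le.2 h.2)
        refine ⟨k, d, hd, ?_⟩
        filter_upwards [self_mem_nhdsWithin, nhdsWithin_le_nhds (Iio_mem_nhds hxb)] with y h2 h3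
        exact h y ⟨h2, le_of_lt h3⟩
      · refine (affineAlong_id _).congr ?_
        rcases le_or_gt 1 x with h | h
        · filter_upwards [self_mem_nhdsWithin] with y hy
          exact extend_of_one_le hmono (le_trans h hy)
        · have hx1 : x < 0 := by
            by_contra hc
            exact hin ⟨not_lt.1 hc, h⟩
          filter_upwards [nhdsWithin_le_nhds (Iio_mem_nhds hx1)] with y hy
          exact extend_of_le_zero hmono (le_of_lt hy)
  · refine Or.inl ?_
    rcases lt_trichotomy x 0 with hx0 | rfl | hx0
    · refine (affineAlong_id _).congr ?_
      filter_upwards [Iio_mem_nhds hx0] with y hy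
      exact extend_of_le_zero hmono (le_of_lt hy)
    · exact absurd h0 hx
    rcases lt_trichotomy x 1 with hx1 | rfl | hx1
    · obtain ⟨a, ha, hax, hmax⟩ := exists_last_le S' h0 hx0.le
      obtain ⟨b, hb, hxb, hmin⟩ := exists_first_ge S' h1 hx1.le
      obtain ⟨k, d, hd, h⟩ := key a ha b (hmax 0 h0 hx0.le) (hax.trans hxb) (hmin 1 h1 hx1.le) (by
        intro s hs h
        rcases le_total s x with hsx | hsx
        · exact absurd (hmax s hs hsx) (not_le.2 h.1)
        · exact absurd (hmin s hs hsx) (not_le.2 h.2))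
      refine ⟨k, d, hd, ?_⟩
      have hax' : a < x := lt_of_le_of_ne hax fun h => hx (h ▸ ha)
      have hxb' : x < b := lt_of_le_of_ne hxb fun h => hx (h ▸ hb)
      filter_upwards [Icc_mem_nhds hax' hxb'] with y hy using h y hy
    · exact absurd h1 hx
    · refine (affineAlong_id _).congr ?_
      filter_upwards [Ioi_mem_nhds hx1] with y hy
      exact extend_of_one_le hmono (le_of_lt hy)

/-- A map which is locally dyadic is affine on each short interval which does not contain a
certain dyadic number in its interior. -/
theorem LocallyDyadicAt.exists_ball {f : ℝ → ℝ} {x : ℝ} (h : LocallyDyadicAt f x) :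
    ∃ s ε : ℝ, IsDyadic s ∧ 0 < ε ∧ ∀ a b, Icc a b ⊆ Metric.ball x ε → s ∉ Ioo a b →
      ∃ (k : ℤ) (d : ℝ), ∀ y ∈ Icc a b, f y = 2 ^ k * y + d := by
  rcases h with ⟨k, d, -, h⟩ | ⟨hx, ⟨k, d, -, h⟩, ⟨l, e, -, h'⟩⟩
  · obtain ⟨ε, hε, h⟩ := Metric.eventually_nhds_iff_ball.1 h
    -- No break point is needed here; `0` is a dummy value.
    exact ⟨0, ε, .zero, hε, fun a b hab _ => ⟨k, d, fun y hy => h y (hab hy)⟩⟩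
  · rw [eventually_nhdsWithin_iff, Metric.eventually_nhds_iff_ball] at h h'
    obtain ⟨ε, hε, h⟩ := h
    obtain ⟨δ, hδ, h'⟩ := h'
    refine ⟨x, min ε δ, hx, lt_min hε hδ, fun a b hab hxab => ?_⟩
    rcases le_or_gt b x with hb | hb
    · exact ⟨k, d, fun y hy => h y (Metric.ball_subset_ball (min_le_left _ _) (hab hy))
        (hy.2.trans hb)⟩
    · have ha : x ≤ a := not_lt.1 fun ha => hxab ⟨ha, hb⟩
      exact ⟨l, e, fun y hy => h' y (Metric.ball_subset_ball (min_le_right _ _) (hab hy))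
        (ha.trans hy.1)⟩

/-- By compactness finitely many balls, each with one possible break point, cover `[0,1]`. Adding a
dyadic grid finer than a Lebesgue number `δ` to the break points forces every interval without break
points inside into a single ball. -/
theorem isThompson_restrict {f : ℝ ≃o ℝ} (h0 : f 0 = 0) (h1 : f 1 = 1)
    (hf : ∀ x, LocallyDyadicAt f x) : IsThompson (restrict f h0 h1) := by
  classical
  refine ⟨fun x y hxy => f.strictMono hxy, ?_⟩
  choose s ε hs hε hball using fun x => (hf x).exists_ball
  obtain ⟨t, -, ht⟩ := (isCompact_Icc (a := (0 : ℝ)) (b := 1)).elim_nhds_subcover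
    (fun x => Metric.ball x (ε x)) (fun x _ => Metric.ball_mem_nhds x (hε x))
  obtain ⟨δ, hδ, hleb⟩ := lebesgue_number_lemma_of_metric (isCompact_Icc (a := (0 : ℝ)) (b := 1))
    (c := fun x : t => Metric.ball (x : ℝ) (ε x)) (fun _ => Metric.isOpen_ball)
    (by simpa only [iUnion_subtype] using ht)
  obtain ⟨n, hn⟩ := exists_pow_lt_of_lt_one hδ (by norm_num : (1 / 2 : ℝ) < 1)
  have hp : (0 : ℝ) < 2 ^ n := by positivity
  rw [one_div, inv_pow, inv_lt_iff_one_lt_mul₀ hp] at hn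
  refine ⟨t.image s ∪ (Finset.range (2 ^ n + 1)).image (fun i : ℕ => (i : ℝ) / 2 ^ n), ?_, ?_⟩
  · intro z hz
    rcases Finset.mem_union.1 hz with hz | hz
    · obtain ⟨x, -, rfl⟩ := Finset.mem_image.1 hz
      exact hs x
    · obtain ⟨i, -, rfl⟩ := Finset.mem_image.1 hz
      exact ⟨i, n, by simp⟩
  · intro a b hab hab'
    have hba : (b : ℝ) - a < δ := by
      by_contra hc
      -- If `b - a ≥ δ`, the first grid point after `a`, namely `(i + 1) / 2 ^ n`, lies strictly
      -- between `a` and `b`.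
      set i := ⌊(a : ℝ) * 2 ^ n⌋₊ with hi
      have ha0 : (0 : ℝ) ≤ a * 2 ^ n := mul_nonneg a.2.1 hp.le
      have hi1 := Nat.floor_le ha0
      have hi2 := Nat.lt_floor_add_one ((a : ℝ) * 2 ^ n)
      rw [← hi] at hi1 hi2
      have hlt : ((i + 1 : ℕ) : ℝ) < b * 2 ^ n := by
        push_cast
        nlinarith [not_lt.1 hc]
      refine hab' (((i + 1 : ℕ) : ℝ) / 2 ^ n) (Finset.mem_union_right _
        (Finset.mem_image_of_mem (fun i : ℕ => (i : ℝ) / 2 ^ n) ?_)) ⟨?_, ?_⟩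
      · rw [Finset.mem_range, ← Nat.cast_lt (α := ℝ)]
        have := b.2.2
        push_cast at hlt ⊢
        nlinarith
      · rw [lt_div_iff₀ hp]
        push_cast
        exact hi2
      · rw [div_lt_iff₀ hp]
        exact hlt
    obtain ⟨x, hx⟩ := hleb a a.2
    have hsub : Icc (a : ℝ) b ⊆ Metric.ball (x : ℝ) (ε x) := by
      refine Subset.trans (fun y hy => ?_) hx
      rw [Metric.mem_ball, Real.dist_eq, abs_lt]
      constructor <;> linarith [hy.1, hy.2]
    obtain ⟨k, d, h⟩ := hball x a b hsub
      (hab' _ (Finset.mem_union_left _ (Finset.mem_image_of_mem s x.2)))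
    refine ⟨k, fun y hy => ?_⟩
    rw [restrict_apply, restrict_apply, h y ⟨hy.1, hy.2⟩, h a ⟨le_rfl, hab⟩]
    ring

/-! ### Conjugating the stabilizers -/

/-- Since `x` is a non-dyadic fixed point, the germ of `h` is a homothety centred at `x` whose
exponent is a period; `forth` turns it into such a homothety at `f x`. -/
theorem ConjugatesAt.locallyDyadicAt_conj {f h : ℝ ≃o ℝ} {x : ℝ} (hf : ConjugatesAt f x)
    (hh : LocallyDyadicAt h x) (hx : h x = x) :
    LocallyDyadicAt (f.symm.trans (h.trans f)) (f x) := by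
  rcases hh with ⟨k, d, hd, hk⟩ | hh
  · have hd' : d = (1 - 2 ^ k) * x := by
      have := hk.self_of_nhds
      rw [hx] at this
      linarith
    obtain ⟨l, hl, he⟩ := hf.forth k (by rwa [mem_periods, ← hd'])
    refine (locallyDyadicAt_homothety hl (f x)).congr ?_
    have ht := tendsto_nhds f.symm (f x)
    rw [f.symm_apply_apply] at ht
    filter_upwards [ht.eventually he, ht.eventually hk] with y h1 h2
    rw [OrderIso.trans_apply, OrderIso.trans_apply, h2, hd', ← homothety_apply, h1,
      f.apply_symm_apply]
  · exact absurd hh.1 hf.not_isDyadic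

theorem conj_mem_H {f : ℝ ≃o ℝ} (h0 : f 0 = 0) (h1 : f 1 = 1) {U V : Finset ℝ}
    (hU : ∀ x ∈ U, x ∈ Icc (0 : ℝ) 1)
    (hf : ∀ x, LocallyDyadicAt f x ∨ (x ∈ U ∧ ConjugatesAt f x))
    (hUV : ∀ y ∈ V, f.symm y ∈ U) {h : HomeoI} (hh : h ∈ H U) :
    restrict f h0 h1 * h * (restrict f h0 h1)⁻¹ ∈ H V := by
  obtain ⟨hhF, hfix⟩ := hh
  have hhT : IsThompson h := hhF
  set e := extend h hhT.1 with he
  have hefix : ∀ x ∈ U, e x = x := by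
    intro x hx
    have h2 := extend_of_mem hhT.1 ⟨x, hU x hx⟩
    rw [hfix ⟨x, hU x hx⟩ hx] at h2
    exact h2
  set g : ℝ ≃o ℝ := f.symm.trans (e.trans f) with hg
  have hgd : ∀ y, LocallyDyadicAt g y := by
    intro y
    obtain ⟨x, rfl⟩ := f.surjective y
    rcases hf x with hx | ⟨hx, hx'⟩
    · have hex : LocallyDyadicAt f (e x) := by
        rcases hf (e x) with h2 | ⟨h2, -⟩
        · exact h2
        -- If `e x` were exceptional it would be a fixed point of `e`, hence equal to `x`, where `f`
        -- is locally dyadic.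
        · rw [e.injective (hefix _ h2)]
          exact hx
      refine hx.symm.trans ?_
      rw [f.symm_apply_apply]
      exact (hhT.locallyDyadicAt x).trans hex
    · exact hx'.locallyDyadicAt_conj (hhT.locallyDyadicAt x) (hefix x hx)
  have hs0 : f.symm 0 = 0 := by rw [f.symm_apply_eq, h0]
  have hs1 : f.symm 1 = 1 := by rw [f.symm_apply_eq, h1]
  have hg0 : g 0 = 0 := by
    simp only [hg, OrderIso.trans_apply, hs0, he, extend_of_le_zero hhT.1 le_rfl, h0]
  have hg1 : g 1 = 1 := by
    simp only [hg, OrderIso.trans_apply, hs1, he, extend_of_one_le hhT.1 le_rfl, h1]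
  have heq : ∀ x : unitInterval,
      ((restrict f h0 h1 * h * (restrict f h0 h1)⁻¹) x : ℝ) = g x := by
    intro x
    change f (h ((restrict f h0 h1)⁻¹ x)) = f (e (f.symm x))
    rw [← restrict_inv_apply f h0 h1, he, extend_of_mem]
  refine ⟨?_, ?_⟩
  · have : restrict f h0 h1 * h * (restrict f h0 h1)⁻¹ = restrict g hg0 hg1 := by
      ext x
      rw [heq, restrict_apply]
    rw [this]
    exact isThompson_restrict hg0 hg1 hgd
  · intro x hx
    apply Subtype.ext
    rw [heq]
    change f (e (f.symm x)) = x
    rw [hefix _ (hUV x hx), f.apply_symm_apply]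

/-! ### Binary words and dyadic intervals -/

theorem digit_nonneg (b : Bool) : 0 ≤ digit b := by cases b <;> simp [digit]

theorem digit_le_one (b : Bool) : digit b ≤ 1 := by cases b <;> simp [digit]

theorem finVal_append (u w : List Bool) : finVal (u ++ w) = finVal u + finVal w / 2 ^ u.length := by
  induction u with
  | nil => simp [finVal]
  | cons b u ih =>
    simp only [List.cons_append, finVal, ih, List.length_cons]
    field_simp
    ring

theorem exists_finVal_eq (w : List Bool) :
    ∃ j : ℕ, j < 2 ^ w.length ∧ finVal w = j / 2 ^ w.length := by
  induction w with
  | nil => exact ⟨0, by simp, by simp [finVal]⟩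
  | cons b w ih =>
    obtain ⟨j, hj, hw⟩ := ih
    refine ⟨(if b then 1 else 0) * 2 ^ w.length + j, ?_, ?_⟩
    · rw [List.length_cons, pow_succ]
      split_ifs <;> omega
    · rw [finVal, hw, List.length_cons, pow_succ]
      cases b <;> simp [digit] <;> field_simp

theorem exists_word_finVal_eq (m j : ℕ) (hj : j < 2 ^ m) :
    ∃ w : List Bool, w.length = m ∧ finVal w = j / 2 ^ m := by
  induction m generalizing j with
  | zero =>
    obtain rfl : j = 0 := by simpa using hj
    exact ⟨[], rfl, by simp [finVal]⟩
  | succ m ih =>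
    rw [pow_succ] at hj
    rcases lt_or_ge j (2 ^ m) with h | h
    · obtain ⟨w, hw, hv⟩ := ih j h
      refine ⟨false :: w, by simp [hw], ?_⟩
      rw [finVal, hv, digit, pow_succ]
      simp
      field_simp
    · obtain ⟨w, hw, hv⟩ := ih (j - 2 ^ m) (by omega)
      refine ⟨true :: w, by simp [hw], ?_⟩
      rw [finVal, hv, digit, pow_succ, Nat.cast_sub h]
      simp
      field_simp
      ring

theorem isDyadic_finVal (w : List Bool) : IsDyadic (finVal w) := by
  obtain ⟨j, -, h⟩ := exists_finVal_eq w
  exact ⟨j, w.length, by simpa using h⟩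

theorem isDyadic_one_div_two_pow (n : ℕ) : IsDyadic (1 / 2 ^ n) := ⟨1, n, by simp⟩

/-- The interval `[w]`. -/
def cell (w : List Bool) : Set ℝ := Icc (finVal w) (finVal w + 1 / 2 ^ w.length)

theorem mem_cell {w : List Bool} {x : ℝ} :
    x ∈ cell w ↔ finVal w ≤ x ∧ x ≤ finVal w + 1 / 2 ^ w.length := Iff.rfl

theorem cell_subset_unitInterval (w : List Bool) : cell w ⊆ Icc 0 1 := by
  obtain ⟨j, hj, hw⟩ := exists_finVal_eq w
  have hj' : ((j + 1 : ℕ) : ℝ) ≤ (2 ^ w.length : ℕ) := Nat.cast_le.2 hj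
  push_cast at hj'
  intro x hx
  rw [mem_cell, hw, ← add_div] at hx
  exact ⟨le_trans (by positivity) hx.1, hx.2.trans (div_le_one_of_le₀ hj' (by positivity))⟩

theorem cell_append_subset (u w : List Bool) : cell (u ++ w) ⊆ cell u := by
  intro x hx
  have hw : finVal w ∈ cell w := ⟨le_rfl, by simp⟩
  have hw' : finVal w + 1 / 2 ^ w.length ∈ cell w := ⟨by simp, le_rfl⟩
  have h0 := (cell_subset_unitInterval w hw).1
  have h1 := (cell_subset_unitInterval w hw').2
  rw [mem_cell, finVal_append, List.length_append, pow_add] at hx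
  refine ⟨le_trans ?_ hx.1, hx.2.trans ?_⟩
  · have : 0 ≤ finVal w / 2 ^ u.length := by positivity
    linarith
  · calc finVal u + finVal w / 2 ^ u.length + 1 / (2 ^ u.length * 2 ^ w.length)
        = finVal u + (finVal w + 1 / 2 ^ w.length) / 2 ^ u.length := by field_simp; ring
      _ ≤ _ := by gcongr

theorem cell_subset_of_prefix {u w : List Bool} (h : u <+: w) : cell w ⊆ cell u := by
  obtain ⟨t, rfl⟩ := h
  exact cell_append_subset u t

theorem finVal_injective {w w' : List Bool} (hl : w.length = w'.length)
    (h : finVal w = finVal w') : w = w' := by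
  have hlt : ∀ w, finVal w < 1 := by
    intro w
    have : finVal w + 1 / 2 ^ w.length ≤ 1 :=
      (cell_subset_unitInterval w ⟨by simp, le_rfl⟩).2
    have h2 : (0 : ℝ) < 1 / 2 ^ w.length := by positivity
    linarith
  have hge : ∀ w, 0 ≤ finVal w := fun w => (cell_subset_unitInterval w ⟨le_rfl, by simp⟩).1
  induction w generalizing w' with
  | nil => exact (List.length_eq_zero_iff.1 hl.symm).symm
  | cons b w ih =>
    cases w' with
    | nil => simp at hl
    | cons b' w' =>
      have h' : digit b + finVal w = digit b' + finVal w' := by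
        simp only [finVal] at h
        linarith
      have := hlt w
      have := hlt w'
      have := hge w
      have := hge w'
      have hb : b = b' := by
        cases b <;> cases b' <;> simp [digit] at h' ⊢ <;> linarith
      subst hb
      rw [ih (by simpa using hl) (by linarith)]

/-- Cells of one length `n` meet only at multiples of `2 ^ (-n)`; for non-dyadic `x` the numerator
of the left end point must be `⌊x * 2 ^ n⌋`. -/
theorem eq_of_mem_cell {w w' : List Bool} (hl : w.length = w'.length) {x : ℝ}
    (hx : ¬ IsDyadic x) (h : x ∈ cell w) (h' : x ∈ cell w') : w = w' := by
  have key : ∀ w : List Bool, x ∈ cell w → finVal w = ⌊x * 2 ^ w.length⌋ / 2 ^ w.length := by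
    intro w hw
    obtain ⟨j, -, hj⟩ := exists_finVal_eq w
    have hp : (0 : ℝ) < 2 ^ w.length := by positivity
    have hne : x ≠ finVal w + 1 / 2 ^ w.length := fun h =>
      hx (h ▸ (isDyadic_finVal w).add (isDyadic_one_div_two_pow _))
    have h1 := hw.1
    have h2 := lt_of_le_of_ne hw.2 hne
    rw [hj, div_le_iff₀ hp] at h1
    rw [hj, ← add_div, lt_div_iff₀ hp] at h2
    have : ⌊x * 2 ^ w.length⌋ = (j : ℤ) := by
      rw [Int.floor_eq_iff]
      exact ⟨by exact_mod_cast h1, by exact_mod_cast h2⟩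
    rw [hj, this]
    simp
  exact finVal_injective hl (by rw [key w h, key w' h', hl])

/-- An irrational point of `cell w` lies both in `cell u` and in the cell of the prefix of `w` of
length `|u|`, so these two words agree. -/
theorem prefix_of_cell_subset {u w : List Bool} (h : cell w ⊆ cell u) : u <+: w := by
  have hpw : (0 : ℝ) < 1 / 2 ^ w.length := by positivity
  have h1 := h (show finVal w ∈ cell w from ⟨le_rfl, by linarith⟩)
  have h2 := h (show finVal w + 1 / 2 ^ w.length ∈ cell w from ⟨by linarith, le_rfl⟩)
  have hle : (1 : ℝ) / 2 ^ w.length ≤ 1 / 2 ^ u.length := by linarith [h1.1, h2.2]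
  have hlen : u.length ≤ w.length := by
    rw [one_div_le_one_div (by positivity) (by positivity)] at hle
    exact (pow_le_pow_iff_right₀ (by norm_num : (1 : ℝ) < 2)).1 hle
  obtain ⟨x, hx, hx1, hx2⟩ := exists_irrational_btwn (show finVal w < finVal w + 1 / 2 ^ w.length by
    linarith)
  have hxw : x ∈ cell w := ⟨hx1.le, hx2.le⟩
  have : u = w.take u.length := eq_of_mem_cell (by simp [hlen]) (fun hd => hd.not_irrational hx)
    (h hxw) (cell_subset_of_prefix (List.take_prefix _ _) hxw)
  rw [this]
  exact List.take_prefix _ _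

theorem initWord_length (ω : ℕ → Bool) (n : ℕ) : (initWord ω n).length = n := by
  simp [initWord]

theorem initWord_succ (ω : ℕ → Bool) (n : ℕ) : initWord ω (n + 1) = initWord ω n ++ [ω n] := by
  simp [initWord, List.range_succ]

theorem initWord_take (ω : ℕ → Bool) {m n : ℕ} (h : m ≤ n) :
    (initWord ω n).take m = initWord ω m := by
  rw [initWord, ← List.map_take, List.take_range, min_eq_left h, initWord]

theorem summable_digit (ω : ℕ → Bool) : Summable fun i => digit (ω i) / 2 ^ (i + 1) := by
  refine Summable.of_nonneg_of_le (fun i => div_nonneg (digit_nonneg _) (by positivity))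
    (fun i => ?_) (hasSum_geometric_two' 1).summable
  rw [div_div, ← pow_succ']
  gcongr
  exact digit_le_one _

theorem infVal_nonneg (ω : ℕ → Bool) : 0 ≤ infVal ω :=
  tsum_nonneg fun _ => div_nonneg (digit_nonneg _) (by positivity)

theorem infVal_le_one (ω : ℕ → Bool) : infVal ω ≤ 1 := by
  rw [← (hasSum_geometric_two' 1).tsum_eq]
  refine (summable_digit ω).tsum_le_tsum (fun i => ?_) (hasSum_geometric_two' 1).summable
  rw [div_div, ← pow_succ']
  gcongr
  exact digit_le_one _

theorem infVal_eq_shift (ω : ℕ → Bool) :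
    infVal ω = (digit (ω 0) + infVal fun i => ω (i + 1)) / 2 := by
  rw [infVal, (summable_digit ω).tsum_eq_zero_add, infVal, add_div, ← tsum_div_const]
  congr 1
  · simp
  · refine tsum_congr fun i => ?_
    rw [pow_succ, div_div]

theorem infVal_eq_initWord_add (ω : ℕ → Bool) (n : ℕ) :
    infVal ω = finVal (initWord ω n) + (infVal fun i => ω (i + n)) / 2 ^ n := by
  induction n with
  | zero => simp [initWord, finVal]
  | succ n ih =>
    rw [ih, infVal_eq_shift, initWord_succ, finVal_append, initWord_length]
    have : (fun i => ω (i + 1 + n)) = fun i => ω (i + (n + 1)) := by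
      funext i
      congr 1
      ring
    rw [this, zero_add]
    simp only [finVal, pow_succ]
    field_simp
    ring

theorem infVal_mem_cell (ω : ℕ → Bool) (n : ℕ) : infVal ω ∈ cell (initWord ω n) := by
  rw [mem_cell, infVal_eq_initWord_add ω n, initWord_length]
  have h0 := infVal_nonneg fun i => ω (i + n)
  have h1 := infVal_le_one fun i => ω (i + n)
  constructor
  · have : 0 ≤ (infVal fun i => ω (i + n)) / 2 ^ n := by positivity
    linarith
  · gcongr

theorem eq_initWord_of_mem_cell {ω : ℕ → Bool} {w : List Bool} (hω : ¬ IsDyadic (infVal ω))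
    (h : infVal ω ∈ cell w) : w = initWord ω w.length :=
  eq_of_mem_cell (initWord_length _ _).symm hω h (infVal_mem_cell _ _)

theorem infVal_injective {ω ω' : ℕ → Bool} (hω : ¬ IsDyadic (infVal ω))
    (h : infVal ω = infVal ω') : ω = ω' := by
  funext n
  have h1 : initWord ω' (n + 1) = initWord ω (n + 1) := by
    have := eq_initWord_of_mem_cell hω (h ▸ infVal_mem_cell ω' (n + 1))
    rwa [initWord_length] at this
  rw [initWord_succ, initWord_succ] at h1
  simpa using (List.append_inj_right' h1 rfl).symm

theorem exists_infVal_eq {x : ℝ} (hx : x ∈ Ico (0 : ℝ) 1) : ∃ ω, infVal ω = x := by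
  refine ⟨fun i => Real.digits x 2 i = 1, ?_⟩
  refine Eq.trans (tsum_congr fun i => ?_) (Real.ofDigits_digits (b := 2) (by norm_num) hx)
  have hd : ∀ a : Fin 2, digit (decide (a = 1)) = ((a : ℕ) : ℝ) := by
    intro a
    fin_cases a <;> simp [digit]
  rw [Real.ofDigitsTerm, div_eq_mul_inv, hd, Nat.cast_ofNat]

/-! ### Linear maps between dyadic intervals -/

/-- `f` maps the interval `[u]` linearly onto `[v]`. -/
def MapsCell (f : ℝ ≃o ℝ) (u v : List Bool) : Prop :=
  ∀ x ∈ cell u, f x = finVal v + (x - finVal u) * 2 ^ u.length / 2 ^ v.length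

theorem affine_mem_cell {u v : List Bool} {x : ℝ} (hx : x ∈ cell u) :
    finVal v + (x - finVal u) * 2 ^ u.length / 2 ^ v.length ∈ cell v := by
  have h1 : 0 ≤ x - finVal u := by linarith [hx.1]
  have h2 : (x - finVal u) * 2 ^ u.length ≤ 1 := by
    rw [← le_div_iff₀ (by positivity)]
    linarith [hx.2]
  constructor
  · have : 0 ≤ (x - finVal u) * 2 ^ u.length / 2 ^ v.length := by positivity
    linarith
  · gcongr

theorem MapsCell.mapsTo {f : ℝ ≃o ℝ} {u v : List Bool} (h : MapsCell f u v) {x : ℝ}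
    (hx : x ∈ cell u) : f x ∈ cell v := by
  rw [h x hx]
  exact affine_mem_cell hx

theorem MapsCell.symm {f : ℝ ≃o ℝ} {u v : List Bool} (h : MapsCell f u v) :
    MapsCell f.symm v u := by
  intro y hy
  rw [f.symm_apply_eq, h _ (affine_mem_cell hy)]
  field_simp
  ring

theorem MapsCell.unique {f : ℝ ≃o ℝ} {u v v' : List Bool} (h : MapsCell f u v)
    (h' : MapsCell f u v') : v = v' := by
  have key : ∀ v v', MapsCell f u v → MapsCell f u v' → cell v ⊆ cell v' := by
    intro v v' h h' y hy
    have := h'.mapsTo (h.symm.mapsTo hy)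
    rwa [f.apply_symm_apply] at this
  exact (prefix_of_cell_subset (key v' v h' h)).eq_of_length_le
    (prefix_of_cell_subset (key v v' h h')).length_le

/-- `f` maps the interval `[w]` linearly onto an interval of the same kind. -/
def IsGood (f : ℝ ≃o ℝ) (w : List Bool) : Prop := ∃ v, MapsCell f w v

/-- The image has length `2 ^ (-N)`, and `m ≤ N` puts its left end on the grid of that mesh. It
stays in `[0,1]` because `f` fixes `0` and `1`, so it is a cell. -/
theorem isGood_of_affine {f : ℝ ≃o ℝ} (h0 : f 0 = 0) (h1 : f 1 = 1) {k a : ℤ} {m N : ℕ}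
    {w : List Bool} (hN : (w.length : ℤ) = N + k) (hm : m ≤ N)
    (h : ∀ x ∈ cell w, f x = 2 ^ k * x + a / 2 ^ m) : IsGood f w := by
  have hpow : (2 : ℝ) ^ k = 2 ^ w.length / 2 ^ N := by
    rw [eq_div_iff (by positivity), ← zpow_natCast, ← zpow_natCast, ← zpow_add₀ two_ne_zero, hN,
      add_comm]
  obtain ⟨j, -, hj⟩ := exists_finVal_eq w
  set i : ℤ := j + a * 2 ^ (N - m) with hi
  have hleft : finVal w ∈ cell w := ⟨le_rfl, by simp⟩
  have hright : finVal w + 1 / 2 ^ w.length ∈ cell w := ⟨by simp, le_rfl⟩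
  have hmN : (2 : ℝ) ^ N = 2 ^ (N - m) * 2 ^ m := by rw [← pow_add, Nat.sub_add_cancel hm]
  have hi' : (2 : ℝ) ^ k * finVal w + a / 2 ^ m = i / 2 ^ N := by
    rw [hpow, hj, hi]
    push_cast
    rw [add_div]
    congr 1
    · field_simp
    · rw [hmN]
      field_simp
  have hl : f (finVal w) = i / 2 ^ N := by rw [h _ hleft, hi']
  have hr : f (finVal w + 1 / 2 ^ w.length) = (i + 1) / 2 ^ N := by
    rw [h _ hright, mul_add, add_right_comm, hi', add_div, hpow]
    congr 1
    field_simp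
  have hi0 : 0 ≤ i := by
    have h2 : f 0 ≤ f (finVal w) := f.monotone (cell_subset_unitInterval w hleft).1
    rw [h0, hl, le_div_iff₀ (by positivity), zero_mul] at h2
    exact_mod_cast h2
  have hi1 : i + 1 ≤ 2 ^ N := by
    have h2 : f (finVal w + 1 / 2 ^ w.length) ≤ f 1 :=
      f.monotone (cell_subset_unitInterval w hright).2
    rw [h1, hr, div_le_one (by positivity)] at h2
    exact_mod_cast h2
  obtain ⟨n, hn⟩ := Int.eq_ofNat_of_zero_le hi0
  obtain ⟨v, hv, hv'⟩ := exists_word_finVal_eq N n (by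
    have : (n : ℤ) + 1 ≤ 2 ^ N := hn ▸ hi1
    exact_mod_cast this)
  refine ⟨v, fun x hx => ?_⟩
  have hin : (i : ℝ) = n := by rw [hn]; simp
  rw [h x hx, hv', hv, ← hin, ← hi', hpow]
  field_simp
  ring

theorem AffineAlong.exists_isGood {f : ℝ ≃o ℝ} (h0 : f 0 = 0) (h1 : f 1 = 1) {s : Set ℝ} {x : ℝ}
    (h : AffineAlong (𝓝[s] x) f) :
    ∃ n₀, ∀ w : List Bool, n₀ ≤ w.length → x ∈ cell w → cell w ⊆ s → IsGood f w := by
  obtain ⟨k, d, ⟨a, m, rfl⟩, h⟩ := h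
  rw [eventually_nhdsWithin_iff, Metric.eventually_nhds_iff_ball] at h
  obtain ⟨ε, hε, h⟩ := h
  obtain ⟨n, hn⟩ := exists_pow_lt_of_lt_one hε (by norm_num : (1 / 2 : ℝ) < 1)
  -- The term `n` keeps the cell within `ε` of `x`; `m + |k|` ensures that `|w| - k` is at least
  -- `m`.
  refine ⟨n + m + k.natAbs, fun w hw hx hs => ?_⟩
  refine isGood_of_affine h0 h1 (k := k) (a := a) (m := m) (N := (w.length - k).toNat)
    (by omega) (by omega) fun y hy => h y ?_ (hs hy)
  have hle : (1 : ℝ) / 2 ^ w.length ≤ (1 / 2) ^ n := by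
    rw [one_div_pow]
    gcongr
    · norm_num
    · omega
  rw [Metric.mem_ball, Real.dist_eq, abs_lt]
  constructor <;> linarith [hx.1, hx.2, hy.1, hy.2]

/-- Once the word is at least as long as the exponent of the denominator, `x` is a grid point and
cannot be interior to a cell. -/
theorem IsDyadic.cell_subset {x : ℝ} (hx : IsDyadic x) :
    ∃ n₀, ∀ w : List Bool, n₀ ≤ w.length → x ∈ cell w → cell w ⊆ Iic x ∨ cell w ⊆ Ici x := by
  obtain ⟨a, m, rfl⟩ := hx
  refine ⟨m, fun w hw hx => ?_⟩
  obtain ⟨j, -, hj⟩ := exists_finVal_eq w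
  have hp : (0 : ℝ) < 2 ^ w.length := by positivity
  have hxe : (a : ℝ) / 2 ^ m = (a * 2 ^ (w.length - m) : ℤ) / 2 ^ w.length := by
    rw [← Nat.sub_add_cancel hw, pow_add]
    push_cast
    rw [Nat.sub_add_cancel hw]
    field_simp
  rcases le_or_gt (a * 2 ^ (w.length - m)) (j : ℤ) with h | h
  · right
    intro y hy
    refine le_trans ?_ hy.1
    rw [hxe, hj]
    gcongr
    exact_mod_cast h
  · left
    intro y hy
    refine hy.2.trans ?_
    rw [hxe, hj, ← add_div]
    gcongr
    exact_mod_cast h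

theorem LocallyDyadicAt.exists_isGood {f : ℝ ≃o ℝ} (h0 : f 0 = 0) (h1 : f 1 = 1) {ω : ℕ → Bool}
    (h : LocallyDyadicAt f (infVal ω)) : ∃ n, IsGood f (initWord ω n) := by
  rcases h with h | ⟨hx, hl, hr⟩
  · rw [← nhdsWithin_univ] at h
    obtain ⟨n, hn⟩ := h.exists_isGood h0 h1
    exact ⟨n, hn _ (initWord_length ω n).ge (infVal_mem_cell ω n) (subset_univ _)⟩
  · obtain ⟨n₁, hn₁⟩ := hl.exists_isGood h0 h1
    obtain ⟨n₂, hn₂⟩ := hr.exists_isGood h0 h1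
    obtain ⟨n₃, hn₃⟩ := hx.cell_subset
    have hlen := initWord_length ω (n₁ + n₂ + n₃)
    have hmem := infVal_mem_cell ω (n₁ + n₂ + n₃)
    refine ⟨n₁ + n₂ + n₃, ?_⟩
    rcases hn₃ _ (by omega) hmem with h | h
    · exact hn₁ _ (by omega) hmem h
    · exact hn₂ _ (by omega) hmem h

/-! ### The tree of an admissible map and its branches -/

/-- `f` fixes `0` and `1`, and it is dyadic away from the finite set `N`. -/
structure Admissible (f : ℝ ≃o ℝ) (N : Set ℝ) : Prop where
  finite : N.Finite
  map_zero : f 0 = 0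
  map_one : f 1 = 1
  cases : ∀ x, LocallyDyadicAt f x ∨ (x ∈ N ∧ ConjugatesAt f x)

theorem Admissible.symm {f : ℝ ≃o ℝ} {N : Set ℝ} (hf : Admissible f N) :
    Admissible f.symm (f '' N) where
  finite := hf.finite.image f
  map_zero := by rw [f.symm_apply_eq, hf.map_zero]
  map_one := by rw [f.symm_apply_eq, hf.map_one]
  cases y := by
    obtain ⟨x, rfl⟩ := f.surjective y
    exact (hf.cases x).imp (fun h => h.symm) fun h => ⟨mem_image_of_mem f h.1, h.2.symm⟩

/-- The tree whose finite branches are the maximal dyadic intervals which `f` maps linearly onto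
dyadic intervals. -/
def tree (f : ℝ ≃o ℝ) : BinTree where
  verts := {w | ∀ n < w.length, ¬ IsGood f (w.take n)}
  root_mem := by simp
  parent_mem w b h n hn := by
    have := h n (by simp; omega)
    rwa [List.take_append_of_le_length hn.le] at this
  sibling_mem w b h n hn := by
    have hn' : n ≤ w.length := by simpa using Nat.lt_succ_iff.1 (by simpa using hn)
    have := h n (by simp; omega)
    rw [List.take_append_of_le_length hn'] at this ⊢
    exact this

theorem append_mem_verts {f : ℝ ≃o ℝ} {w : List Bool} {b : Bool} :
    w ++ [b] ∈ (tree f).verts ↔ w ∈ (tree f).verts ∧ ¬ IsGood f w := by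
  refine ⟨fun h => ⟨(tree f).parent_mem w b h, ?_⟩, fun h n hn => ?_⟩
  · simpa using h w.length (by simp)
  · have hn' : n ≤ w.length := by simpa using Nat.lt_succ_iff.1 (by simpa using hn)
    rw [List.take_append_of_le_length hn']
    rcases hn'.eq_or_lt with rfl | hlt
    · simpa using h.2
    · exact h.1 n hlt

theorem isBranch_inl {f : ℝ ≃o ℝ} {w : List Bool} :
    (tree f).IsBranch (Sum.inl w) ↔ w ∈ (tree f).verts ∧ IsGood f w := by
  change (w ∈ (tree f).verts ∧ ∀ b, w ++ [b] ∉ (tree f).verts) ↔ _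
  simp only [append_mem_verts]
  exact ⟨fun h => ⟨h.1, by_contra fun hg => h.2 false ⟨h.1, hg⟩⟩,
    fun h => ⟨h.1, fun _ hb => hb.2 h.2⟩⟩

theorem isBranch_inr {f : ℝ ≃o ℝ} {ω : ℕ → Bool} :
    (tree f).IsBranch (Sum.inr ω) ↔ ∀ n, ¬ IsGood f (initWord ω n) := by
  change (∀ n, initWord ω n ∈ (tree f).verts) ↔ _
  constructor
  · intro h n
    have := h (n + 1)
    rw [initWord_succ, append_mem_verts] at this
    exact this.2
  · intro h n m hm
    rw [initWord_length] at hm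
    rw [initWord_take ω hm.le]
    exact h m

theorem Admissible.conjugatesAt {f : ℝ ≃o ℝ} {N : Set ℝ} (hf : Admissible f N) {ω : ℕ → Bool}
    (hω : (tree f).IsBranch (Sum.inr ω)) : infVal ω ∈ N ∧ ConjugatesAt f (infVal ω) := by
  refine (hf.cases _).resolve_left fun h => ?_
  obtain ⟨n, hn⟩ := h.exists_isGood hf.map_zero hf.map_one
  exact isBranch_inr.1 hω n hn

theorem eq_inl_of_hasPrefix {f : ℝ ≃o ℝ} {w : List Bool} (hw : IsGood f w) {p : Word}
    (hp : (tree f).IsBranch p) (h : HasPrefix w p) : p = Sum.inl w := by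
  cases p with
  | inl w' =>
    have hpre : w <+: w' := h
    rcases hpre.length_le.eq_or_lt with hl | hl
    · rw [hpre.eq_of_length hl]
    · refine absurd ?_ ((isBranch_inl.1 hp).1 w.length hl)
      rwa [← List.prefix_iff_eq_take.1 hpre]
  | inr ω =>
    have hpre : w = initWord ω w.length := h
    exact absurd (hpre ▸ hw) (isBranch_inr.1 hp w.length)

/-- `f` maps the interval `[p]` linearly onto `[q]`. -/
def MapsWord (f : ℝ ≃o ℝ) : Word → Word → Prop
  | Sum.inl u, Sum.inl v => MapsCell f u v
  | Sum.inr ω, Sum.inr ω' => f (infVal ω) = infVal ω'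
  | _, _ => False

theorem MapsWord.symm {f : ℝ ≃o ℝ} {p q : Word} (h : MapsWord f p q) : MapsWord f.symm q p := by
  rcases p with u | ω <;> rcases q with v | ω'
  · exact MapsCell.symm h
  · exact h.elim
  · exact h.elim
  · change f.symm (infVal ω') = infVal ω
    rw [f.symm_apply_eq]
    exact Eq.symm h

theorem MapsWord.mapsLinearly {f : ℝ ≃o ℝ} {p q : Word} (h : MapsWord f p q) (h0 : f 0 = 0)
    (h1 : f 1 = 1) : MapsLinearly (restrict f h0 h1) p q := by
  rcases p with u | ω <;> rcases q with v | ω'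
  · exact fun x hx => h x hx
  · exact h.elim
  · exact h.elim
  · intro x hx
    rw [restrict_apply, hx]
    exact h

/-- Maximality is symmetric under inversion. If a proper prefix of `v` were good for `f.symm`, with
image `u`, then `u` would be a good prefix of `w`, hence `w` itself, and `w` would have two images.
On an infinite branch, a good cell at `f x` would likewise give a good cell at `x`. -/
theorem Admissible.exists_mapsWord {f : ℝ ≃o ℝ} {N : Set ℝ} (hf : Admissible f N) {p : Word}
    (hp : (tree f).IsBranch p) : ∃ q, (tree f.symm).IsBranch q ∧ MapsWord f p q := by
  rcases p with w | ω
  · obtain ⟨hw, v, hv⟩ := isBranch_inl.1 hp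
    refine ⟨Sum.inl v, isBranch_inl.2 ⟨?_, w, hv.symm⟩, hv⟩
    rintro n hn ⟨u, hu⟩
    have hsub : cell w ⊆ cell u := by
      intro x hx
      have := hu.mapsTo (cell_subset_of_prefix (List.take_prefix n v) (hv.mapsTo hx))
      rwa [f.symm_apply_apply] at this
    have hu' : MapsCell f u (v.take n) := hu.symm
    have hpre := prefix_of_cell_subset hsub
    have heq := eq_inl_of_hasPrefix ⟨_, hu'⟩ hp hpre
    rw [Sum.inl.injEq] at heq
    subst heq
    have := congrArg List.length (hv.unique hu')
    rw [List.length_take] at this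
    omega
  · obtain ⟨-, hc⟩ := hf.conjugatesAt hp
    -- The expansion of `f (infVal ω)` is only available on `[0,1)`, so the value `1` has to be
    -- excluded.
    have h1 : infVal ω ≠ 1 := fun h => hc.not_isDyadic (h ▸ .one)
    have hlt : f (infVal ω) < 1 := by
      rw [← hf.map_one]
      exact f.strictMono (lt_of_le_of_ne (infVal_le_one ω) h1)
    have hge : 0 ≤ f (infVal ω) := by
      rw [← hf.map_zero]
      exact f.monotone (infVal_nonneg ω)
    obtain ⟨ω', hω'⟩ := exists_infVal_eq ⟨hge, hlt⟩
    refine ⟨Sum.inr ω', isBranch_inr.2 ?_, hω'.symm⟩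
    rintro n ⟨u, hu⟩
    have hmem := hu.mapsTo (infVal_mem_cell ω' n)
    rw [hω', f.symm_apply_apply] at hmem
    have hu' : MapsCell f u (initWord ω' n) := hu.symm
    have := eq_initWord_of_mem_cell hc.not_isDyadic hmem
    exact isBranch_inr.1 hp u.length (this ▸ ⟨_, hu'⟩)

theorem Admissible.mapsWord_unique {f : ℝ ≃o ℝ} {N : Set ℝ} (hf : Admissible f N) {p q q' : Word}
    (hp : (tree f).IsBranch p) (h : MapsWord f p q) (h' : MapsWord f p q') : q = q' := by
  rcases p with u | ω <;> rcases q with v | ω' <;> rcases q' with v' | ω''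
  · rw [MapsCell.unique h h']
  · exact h'.elim
  · exact h.elim
  · exact h.elim
  · exact h.elim
  · exact h.elim
  · exact h'.elim
  · have e : f (infVal ω) = infVal ω' := h
    have e' : f (infVal ω) = infVal ω'' := h'
    have hd := (hf.conjugatesAt hp).2.not_isDyadic_image
    rw [infVal_injective (e ▸ hd) (e.symm.trans e')]

theorem Admissible.exists_branch_equiv {f : ℝ ≃o ℝ} {N : Set ℝ} (hf : Admissible f N) :
    ∃ φ : (tree f).Branch ≃ (tree f.symm).Branch, ∀ p, MapsWord f p.1 (φ p).1 := by
  choose F hF hF' using fun p : (tree f).Branch => hf.exists_mapsWord p.2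
  let φ : (tree f).Branch → (tree f.symm).Branch := fun p => ⟨F p, hF p⟩
  refine ⟨Equiv.ofBijective φ ⟨fun p p' h => ?_, fun q => ?_⟩, hF'⟩
  · have h' : F p = F p' := congrArg Subtype.val h
    refine Subtype.ext (hf.symm.mapsWord_unique (hF p) (hF' p).symm ?_)
    rw [h']
    exact (hF' p').symm
  · obtain ⟨p, hp, hqp⟩ := hf.symm.exists_mapsWord q.2
    exact ⟨⟨p, hp⟩, Subtype.ext (hf.mapsWord_unique hp (hF' ⟨p, hp⟩) hqp.symm)⟩

/-! ### The left-to-right order of branches -/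

/-- The midpoint of the interval `[p]`. -/
noncomputable def midpt : Word → ℝ
  | Sum.inl w => finVal w + 1 / 2 / 2 ^ w.length
  | Sum.inr ω => infVal ω

theorem MapsWord.map_midpt {f : ℝ ≃o ℝ} {p q : Word} (h : MapsWord f p q) :
    f (midpt p) = midpt q := by
  rcases p with u | ω <;> rcases q with v | ω'
  · have hmem : finVal u + 1 / 2 / 2 ^ u.length ∈ cell u := by
      refine ⟨le_add_of_nonneg_right (by positivity), ?_⟩
      gcongr
      norm_num
    have h' : MapsCell f u v := h
    simp only [midpt]
    rw [h' _ hmem]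
    field_simp
    ring
  · exact h.elim
  · exact h.elim
  · exact h

theorem midpt_mem_Ioo {u : List Bool} {p : Word} (h : HasPrefix u p)
    (hp : ∀ ω, p = Sum.inr ω → ¬ IsDyadic (infVal ω)) :
    midpt p ∈ Ioo (finVal u) (finVal u + 1 / 2 ^ u.length) := by
  cases p with
  | inl w =>
    have h' : u <+: w := h
    have hsub := cell_subset_of_prefix h'
    have hpos : (0 : ℝ) < 1 / 2 / 2 ^ w.length := by positivity
    have heq : (1 : ℝ) / 2 ^ w.length = 1 / 2 / 2 ^ w.length + 1 / 2 / 2 ^ w.length := by ring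
    have h1 := hsub (show finVal w ∈ cell w from ⟨le_rfl, by linarith⟩)
    have h2 := hsub (show finVal w + 1 / 2 ^ w.length ∈ cell w from ⟨by linarith, le_rfl⟩)
    simp only [midpt]
    constructor <;> linarith [h1.1, h2.2]
  | inr ω =>
    have h' : u = initWord ω u.length := h
    have hmem := infVal_mem_cell ω u.length
    rw [← h'] at hmem
    have hd := hp ω rfl
    simp only [midpt]
    refine ⟨lt_of_le_of_ne hmem.1 fun e => hd (e ▸ isDyadic_finVal u),
      lt_of_le_of_ne hmem.2 fun e => hd (e ▸ (isDyadic_finVal u).add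
        (isDyadic_one_div_two_pow _))⟩

/-- The cells of `u0` and `u1` are adjacent and the midpoints are interior to them. Branch order
thus becomes the order of numbers, which `f` preserves. -/
theorem midpt_lt_midpt {p q : Word} (h : IsLeftOf p q)
    (hp : ∀ ω, p = Sum.inr ω → ¬ IsDyadic (infVal ω))
    (hq : ∀ ω, q = Sum.inr ω → ¬ IsDyadic (infVal ω)) : midpt p < midpt q := by
  obtain ⟨u, hup, huq⟩ := h
  have h1 := (midpt_mem_Ioo hup hp).2
  have h2 := (midpt_mem_Ioo huq hq).1
  refine h1.trans (lt_of_le_of_lt (le_of_eq ?_) h2)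
  rw [finVal_append, finVal_append]
  simp only [finVal, digit, List.length_append, List.length_cons, List.length_nil, pow_succ]
  simp
  field_simp

theorem list_prefix_or_diverge : ∀ w w' : List Bool, w <+: w' ∨ w' <+: w ∨
    (∃ u, u ++ [false] <+: w ∧ u ++ [true] <+: w') ∨
    ∃ u, u ++ [false] <+: w' ∧ u ++ [true] <+: w
  | [], _ => Or.inl (List.nil_prefix)
  | _ :: _, [] => Or.inr (Or.inl List.nil_prefix)
  | b :: w, b' :: w' => by
    by_cases hb : b = b'
    · subst hb
      rcases list_prefix_or_diverge w w' with h | h | ⟨u, h, h'⟩ | ⟨u, h, h'⟩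
      · exact Or.inl (by simpa using h)
      · exact Or.inr (Or.inl (by simpa using h))
      · exact Or.inr (Or.inr (Or.inl ⟨b :: u, by simpa using h, by simpa using h'⟩))
      · exact Or.inr (Or.inr (Or.inr ⟨b :: u, by simpa using h, by simpa using h'⟩))
    · right; right
      cases b <;> cases b' <;> simp at hb
      · exact Or.inl ⟨[], by simp, by simp⟩
      · exact Or.inr ⟨[], by simp, by simp⟩

/-- The finite word itself, or the prefix of length `n` of an infinite word. -/
def truncate (n : ℕ) : Word → List Bool
  | Sum.inl w => w
  | Sum.inr ω => initWord ω n

theorem hasPrefix_of_truncate {n : ℕ} {u : List Bool} {p : Word} (h : u <+: truncate n p) :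
    HasPrefix u p := by
  cases p with
  | inl w => exact h
  | inr ω =>
    have h' : u <+: initWord ω n := h
    have hl := h'.length_le
    rw [initWord_length] at hl
    have := List.prefix_iff_eq_take.1 h'
    rwa [initWord_take ω hl] at this

theorem isLeftOf_or_isLeftOf {p q : Word} {n : ℕ} (h : ¬ truncate n p <+: truncate n q)
    (h' : ¬ truncate n q <+: truncate n p) : IsLeftOf p q ∨ IsLeftOf q p := by
  rcases list_prefix_or_diverge (truncate n p) (truncate n q) with h1 | h1 | ⟨u, h1, h2⟩ |
    ⟨u, h1, h2⟩
  · exact absurd h1 h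
  · exact absurd h1 h'
  · exact Or.inl ⟨u, hasPrefix_of_truncate h1, hasPrefix_of_truncate h2⟩
  · exact Or.inr ⟨u, hasPrefix_of_truncate h1, hasPrefix_of_truncate h2⟩

theorem not_truncate_prefix_of_inl {f : ℝ ≃o ℝ} {w : List Bool} {q : Word}
    (hw : (tree f).IsBranch (Sum.inl w)) (hq : (tree f).IsBranch q) (hne : q ≠ Sum.inl w) (n : ℕ) :
    ¬ w <+: truncate n q :=
  fun h => hne (eq_inl_of_hasPrefix (isBranch_inl.1 hw).2 hq (hasPrefix_of_truncate h))

/-- No branch is a prefix of another, so distinct branches diverge at a finite depth; infinite words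
are truncated just far enough to see it. -/
theorem branch_trichotomy {f : ℝ ≃o ℝ} {p q : Word} (hp : (tree f).IsBranch p)
    (hq : (tree f).IsBranch q) (hne : p ≠ q) : IsLeftOf p q ∨ IsLeftOf q p := by
  rcases p with w | ω <;> rcases q with w' | ω'
  · exact isLeftOf_or_isLeftOf (n := 0) (not_truncate_prefix_of_inl hp hq hne.symm 0)
      (not_truncate_prefix_of_inl hq hp hne 0)
  · have h1 := not_truncate_prefix_of_inl hp hq hne.symm w.length
    refine isLeftOf_or_isLeftOf (n := w.length) h1 fun h => h1 ?_
    have h2 : initWord ω' w.length <+: w := h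
    change w <+: initWord ω' w.length
    rw [h2.eq_of_length (initWord_length _ _)]
  · have h1 := not_truncate_prefix_of_inl hq hp hne w'.length
    refine isLeftOf_or_isLeftOf (n := w'.length) (fun h => h1 ?_) h1
    have h2 : initWord ω w'.length <+: w' := h
    change w' <+: initWord ω w'.length
    rw [h2.eq_of_length (initWord_length _ _)]
  · obtain ⟨n, hn⟩ : ∃ n, ω n ≠ ω' n := by
      by_contra hc
      push Not at hc
      exact hne (congrArg Sum.inr (funext hc))
    have key : ∀ ω ω' : ℕ → Bool, initWord ω (n + 1) <+: initWord ω' (n + 1) → ω n = ω' n := by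
      intro ω ω' h
      have := h.eq_of_length (by rw [initWord_length, initWord_length])
      rw [initWord_succ, initWord_succ] at this
      simpa using List.append_inj_right' this rfl
    exact isLeftOf_or_isLeftOf (n := n + 1) (fun h => hn (key _ _ h))
      (fun h => hn (key _ _ h).symm)

theorem Admissible.not_isDyadic {f : ℝ ≃o ℝ} {N : Set ℝ} (hf : Admissible f N) {p : Word}
    (hp : (tree f).IsBranch p) (ω : ℕ → Bool) (h : p = Sum.inr ω) : ¬ IsDyadic (infVal ω) :=
  (hf.conjugatesAt (h ▸ hp)).2.not_isDyadic

theorem Admissible.isLeftOf {f : ℝ ≃o ℝ} {N : Set ℝ} (hf : Admissible f N) {p q p' q' : Word}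
    (hp : (tree f).IsBranch p) (hq : (tree f).IsBranch q) (hp' : (tree f.symm).IsBranch p')
    (hq' : (tree f.symm).IsBranch q') (hpp : MapsWord f p p') (hqq : MapsWord f q q')
    (h : IsLeftOf p q) : IsLeftOf p' q' := by
  have hlt : midpt p' < midpt q' := by
    rw [← hpp.map_midpt, ← hqq.map_midpt]
    exact f.strictMono (midpt_lt_midpt h (hf.not_isDyadic hp) (hf.not_isDyadic hq))
  have hne : p' ≠ q' := fun e => hlt.ne (e ▸ rfl)
  refine (branch_trichotomy hp' hq' hne).resolve_right fun h' => ?_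
  exact lt_asymm hlt (midpt_lt_midpt h' (hf.symm.not_isDyadic hq') (hf.symm.not_isDyadic hp'))

/-! ### Counting infinite branches and membership in `𝓕` -/

theorem Admissible.injOn_infVal {f : ℝ ≃o ℝ} {N : Set ℝ} (hf : Admissible f N) :
    InjOn infVal (tree f).infBranches := fun _ hω _ _ h =>
  infVal_injective (hf.conjugatesAt hω).2.not_isDyadic h

theorem Admissible.finite_infBranches {f : ℝ ≃o ℝ} {N : Set ℝ} (hf : Admissible f N) :
    (tree f).infBranches.Finite :=
  Set.Finite.of_injOn (fun _ hω => (hf.conjugatesAt hω).1) hf.injOn_infVal hf.finite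

theorem Admissible.image_infVal_subset {f : ℝ ≃o ℝ} {N : Set ℝ} (hf : Admissible f N) :
    f '' (infVal '' (tree f).infBranches) ⊆ infVal '' (tree f.symm).infBranches := by
  rintro _ ⟨_, ⟨ω, hω, rfl⟩, rfl⟩
  obtain ⟨q, hq, hq'⟩ := hf.exists_mapsWord (p := Sum.inr ω) hω
  rcases q with v | ω'
  · exact hq'.elim
  · exact ⟨ω', hq, Eq.symm hq'⟩

/-- Infinite branches have non-dyadic values, so they are counted by those values, and `f` matches
the values of its own tree with those of the tree of `f.symm`. -/
theorem Admissible.ncard_infBranches {f : ℝ ≃o ℝ} {N : Set ℝ} (hf : Admissible f N) :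
    (tree f).infBranches.ncard = (tree f.symm).infBranches.ncard := by
  rw [← hf.injOn_infVal.ncard_image, ← hf.symm.injOn_infVal.ncard_image,
    ← ncard_image_of_injective _ f.injective]
  congr 1
  refine Subset.antisymm hf.image_infVal_subset fun y hy => ?_
  exact ⟨f.symm y, hf.symm.image_infVal_subset ⟨y, hy, rfl⟩, f.apply_symm_apply y⟩

theorem Admissible.restrict_mem_calF {f : ℝ ≃o ℝ} {N : Set ℝ} (hf : Admissible f N) :
    restrict f hf.map_zero hf.map_one ∈ calF := by
  obtain ⟨φ, hφ⟩ := hf.exists_branch_equiv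
  refine ⟨⟨tree f, tree f.symm, φ, hf.finite_infBranches, hf.symm.finite_infBranches,
    hf.ncard_infBranches, fun p q h => hf.isLeftOf p.2 q.2 (φ p).2 (φ q).2 (hφ p) (hφ q) h,
    fun p hp => ?_⟩, fun p => (hφ p).mapsLinearly _ _⟩
  have h := hφ p
  generalize (φ p).1 = q at h ⊢
  generalize p.1 = r at h hp
  rcases r with u | ω <;> rcases q with v | ω'
  · exact absurd hp (by simp)
  · rfl
  · exact h.elim
  · rfl

/-! ### The conjugating element -/

theorem Admissible.map_H_eq {f : ℝ ≃o ℝ} {U V : Finset ℝ} (hf : Admissible f U)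
    (hU : ∀ x ∈ U, x ∈ Icc (0 : ℝ) 1) (hV : ∀ x ∈ V, x ∈ Icc (0 : ℝ) 1)
    (hUV : f '' U = V) :
    (H U).map (MulAut.conj (restrict f hf.map_zero hf.map_one)).toMonoidHom = H V := by
  have hmem : ∀ x ∈ U, f x ∈ V := fun x hx => by
    rw [← Finset.mem_coe, ← hUV]
    exact mem_image_of_mem f hx
  have hmem' : ∀ y ∈ V, f.symm y ∈ U := fun y hy => by
    rw [← Finset.mem_coe, ← hUV] at hy
    obtain ⟨x, hx, rfl⟩ := hy
    rwa [f.symm_apply_apply]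
  ext g
  constructor
  · rintro ⟨h, hh, rfl⟩
    exact conj_mem_H _ _ hU hf.cases hmem' hh
  · intro hg
    -- The reverse inclusion is the forward one for the inverse map, which is admissible with
    -- exceptional set `V`.
    have hs := hf.symm
    rw [hUV] at hs
    have hinv : restrict f.symm hs.map_zero hs.map_one =
        (restrict f hf.map_zero hf.map_one)⁻¹ := by
      ext x
      rfl
    refine ⟨(restrict f hf.map_zero hf.map_one)⁻¹ * g * restrict f hf.map_zero hf.map_one, ?_, ?_⟩
    · have := conj_mem_H hs.map_zero hs.map_one hV hs.cases hmem hg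
      rwa [hinv, inv_inv] at this
    · simp [mul_assoc]

/-- Padding both sequences with `0` and `1` makes the map fix these end points; being dyadic, they
are never exceptional. -/
theorem exists_admissible {U V : Finset ℝ} (hU : ∀ x ∈ U, x ∈ Ioo (0 : ℝ) 1)
    (hV : ∀ x ∈ V, x ∈ Ioo (0 : ℝ) 1) (hUV : typeWord U = typeWord V) :
    ∃ f : ℝ ≃o ℝ, Admissible f U ∧ f '' U = V := by
  have hsorted : ∀ W : Finset ℝ, (∀ x ∈ W, x ∈ Ioo (0 : ℝ) 1) →
      (0 :: (W.sort (· ≤ ·) ++ [1])).Pairwise (· < ·) := by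
    intro W hW
    rw [List.pairwise_cons, List.pairwise_append]
    refine ⟨?_, W.sortedLT_sort.pairwise, List.pairwise_singleton _ _, ?_⟩
    · intro x hx
      rw [List.mem_append, Finset.mem_sort, List.mem_singleton] at hx
      rcases hx with hx | rfl
      · exact (hW x hx).1
      · exact zero_lt_one
    · intro x hx y hy
      rw [Finset.mem_sort] at hx
      rw [List.mem_singleton.1 hy]
      exact (hW x hx).2
  have hlet : (0 :: (U.sort (· ≤ ·) ++ [1])).map letter =
      (0 :: (V.sort (· ≤ ·) ++ [1])).map letter := by
    rw [List.map_cons, List.map_cons, List.map_append, List.map_append]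
    congr 2
  obtain ⟨f, hf, hf1, hf2⟩ := exists_admissible_map _ _ (hsorted U hU) (hsorted V hV) hlet
  rw [List.map_cons, List.map_append, List.cons.injEq] at hf
  obtain ⟨h0, hf⟩ := hf
  obtain ⟨hsort, h1⟩ := List.append_inj' hf rfl
  have h1' : f 1 = 1 := by simpa using h1
  refine ⟨f, ⟨U.finite_toSet, h0, h1', fun x => ?_⟩, ?_⟩
  · by_cases hx : x ∈ 0 :: (U.sort (· ≤ ·) ++ [1])
    · refine (hf2 x hx).imp id fun h => ⟨?_, h⟩
      rw [List.mem_cons, List.mem_append, Finset.mem_sort, List.mem_singleton] at hx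
      rcases hx with rfl | hx | rfl
      · exact absurd .zero h.not_isDyadic
      · exact hx
      · exact absurd .one h.not_isDyadic
    · exact Or.inl (hf1 x hx)
  · ext y
    rw [Finset.mem_coe, ← Finset.mem_sort (· ≤ ·), ← hsort, List.mem_map]
    simp

end Thompson

theorem theoremt (U V : Finset ℝ)
    (hU : ∀ x ∈ U, x ∈ Set.Ioo (0 : ℝ) 1) (hV : ∀ x ∈ V, x ∈ Set.Ioo (0 : ℝ) 1)
    (hUV : Thompson.typeWord U = Thompson.typeWord V) :
    ∃ f ∈ Thompson.calF,
      (Thompson.H U).map (MulAut.conj f).toMonoidHom = Thompson.H V := by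
  obtain ⟨f, hf, hfUV⟩ := Thompson.exists_admissible hU hV hUV
  exact ⟨_, hf.restrict_mem_calF, hf.map_H_eq (fun x hx => Set.Ioo_subset_Icc_self (hU x hx))
    (fun x hx => Set.Ioo_subset_Icc_self (hV x hx)) hfUV⟩
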